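/- Let $n\ge 3$. A hypersurface means a smooth immersion $f$ of a smooth $n$-dimensional manifold $M$ without boundary into $\mathbb R^{n+1}$, together with a smooth unit normal field $N$; its shape operator $A$ is given by $df(Av)=-dN(v)$. It is bi-umbilical of type number two if at each point $p$ there are a number $\nu(p)\neq 0$ and two vectors $X,Y$ of $T_pM$, orthonormal for the induced metric, with $AX=\nu X$, $AY=\nu Y$ and $Ax=0$ for every $x\in T_pM$ orthogonal to $X$ and $Y$ (that is, two principal curvatures are equal to $\nu\ne0$ and the other $n-2$ are zero). The distribution $\Delta$ is spanned at each point by the principal vectors with nonzero principal curvature, i.e. $\Delta_p=\operatorname{span}\{X,Y\}$. An integral surface of $\Delta$ is a connected 2-dimensional smooth manifold $S$ with a smooth immersion $\varphi:S\to M$ such that $d\varphi(T_sS)=\Delta_{\varphi(s)}$ for all $s\in S$. (i) If $f$ is a bi-umbilical hypersurface of type number two and $\varphi:S\to M$ is an integral surface of its distribution $\Delta$, then $f(\varphi(S))$ lies on a two-dimensional round sphere contained in a 3-dimensional affine subspace of $\mathbb R^{n+1}$: there are a 3-dimensional linear subspace $V$, a point $c$ and $r>0$ such that $f(\varphi(s))\in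 c+V$ and $|f(\varphi(s))-c|=r$ for all $s\in S$. (ii) Conversely, every two-dimensional round sphere generates a family of bi-umbilical hypersurfaces of type number two. Precisely, let $V\subset\mathbb R^{n+1}$ be a linear subspace of dimension 3, $c\in\mathbb R^{n+1}$ and $r>0$, and consider the sphere of centre $c$ and radius $r$ in $c+V$, with points $z=c+rq$, where $q$ runs through the unit sphere $S^2$ of $V$. Let $\{e,e_2,\dots,e_{n-2}\}$ be any orthonormal basis of $V^\perp$ and $\alpha$ any real constant with $\cos\alpha\ne 0$, and put $$N=\cos\alpha\, q+\sin\alpha\, e,\qquad e_1=-\sin\alpha\, q+\cos\alpha\, e .$$ Then $$f(q,w)=c+rq+\sum_{i=1}^{n-2}w^i e_i ,\qquad (q,w)\in S^2\times\mathbb R^{n-2},\quad r-w^1\sin\alpha\neq 0,$$ is a bi-umbilical hypersurface of type number two with unit normal field $N$, and $q\mapsto (q,0)$ is an integral surface of its distribution $\Delta$, whose image under $f$ is the given sphere. -/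

import Mathlib

open scoped Manifold ContDiff InnerProductSpace

noncomputable section

namespace BiUmbilical

/-- The Euclidean space `ℝⁿ⁺¹` in which hypersurfaces of dimension `n` lie. -/
abbrev Ambient (n : ℕ) : Type := EuclideanSpace ℝ (Fin (n + 1))

section Hypersurface

variable {n : ℕ}
  {E₀ : Type*} [NormedAddCommGroup E₀] [NormedSpace ℝ E₀]
  {H : Type*} [TopologicalSpace H] (I : ModelWithCorners ℝ E₀ H)
  {M : Type*} [TopologicalSpace M] [ChartedSpace H M]

/-- `f`, restricted to the open set `U` of the manifold `M`, is a smooth (immersed) hypersurface of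
dimension `n` in `ℝⁿ⁺¹`, and `N` is a smooth unit normal field along it. -/
structure IsHypersurface (U : Set M) (f N : M → Ambient n) : Prop where
  isOpen : IsOpen U
  finrank_eq : Module.finrank ℝ E₀ = n
  contMDiffOn : ContMDiffOn I 𝓘(ℝ, Ambient n) ∞ f U
  injective_deriv : ∀ p ∈ U, Function.Injective (mvfderiv I f p)
  normal_contMDiffOn : ContMDiffOn I 𝓘(ℝ, Ambient n) ∞ N U
  normal_norm : ∀ p ∈ U, ‖N p‖ = 1
  normal_orthogonal : ∀ p ∈ U, ∀ v : TangentSpace I p, ⟪N p, mvfderiv I f p v⟫_ℝ = 0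

/-- The first fundamental form (induced metric) at `p`. -/
def firstForm (f : M → Ambient n) (p : M) (v w : TangentSpace I p) : ℝ :=
  ⟪mvfderiv I f p v, mvfderiv I f p w⟫_ℝ

/-- The shape operator `A` of the hypersurface `f` with unit normal field `N`, at the point `p`:
the endomorphism of the tangent space with `df (A v) = -dN v`. As `f` is an immersion and the
values of `dN` are orthogonal to `N`, i.e. lie in the range of `df`, it is obtained from `-dN` by
applying a left inverse of `df`. -/
def shapeOperator (f N : M → Ambient n) (p : M) : Module.End ℝ (TangentSpace I p) :=
  -((mvfderiv I f p).toLinearMap.leftInverse ∘ₗ (mvfderiv I N p).toLinearMap)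

/-- The point `p` is of type number two, with nonzero principal curvatures `ν₁` and `ν₂` (and the
other `n - 2` principal curvatures equal to zero): there are orthonormal principal vectors `X`, `Y`
for `ν₁`, `ν₂`, and the shape operator vanishes on the orthogonal complement of `X`, `Y`. -/
def IsTypeNumberTwoAt (f N : M → Ambient n) (p : M) (ν₁ ν₂ : ℝ) : Prop :=
  ν₁ ≠ 0 ∧ ν₂ ≠ 0 ∧
    ∃ X Y : TangentSpace I p,
      firstForm I f p X X = 1 ∧ firstForm I f p Y Y = 1 ∧ firstForm I f p X Y = 0 ∧
      shapeOperator I f N p X = ν₁ • X ∧ shapeOperator I f N p Y = ν₂ • Y ∧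
      ∀ x : TangentSpace I p, firstForm I f p x X = 0 → firstForm I f p x Y = 0 →
        shapeOperator I f N p x = 0

/-- `f` on `U`, with unit normal field `N`, is a bi-umbilical hypersurface of type number two:
`ν₁ = ν₂ ≠ 0` at each point (the common value may depend on the point). -/
structure IsBiUmbilical (U : Set M) (f N : M → Ambient n) : Prop extends
    IsHypersurface I U f N where
  biumbilical : ∀ p ∈ U, ∃ ν : ℝ, IsTypeNumberTwoAt I f N p ν ν

/-- The distribution `Δ`: at each point, the span of the principal vectors with nonzero
principal curvature. -/
def distributionΔ (f N : M → Ambient n) (p : M) : Submodule ℝ (TangentSpace I p) :=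
  Submodule.span ℝ {v | ∃ ν : ℝ, ν ≠ 0 ∧ shapeOperator I f N p v = ν • v}

/-- The immersed surface `φ : S → M` lies in `U` and is an integral surface of the
distribution `Δ`. -/
structure IsIntegralSurface (U : Set M) (f N : M → Ambient n)
    {S : Type*} [TopologicalSpace S] [ChartedSpace (EuclideanSpace ℝ (Fin 2)) S]
    (φ : S → M) : Prop where
  mem : ∀ s, φ s ∈ U
  contMDiff : ContMDiff (𝓡 2) I ∞ φ
  injective_deriv : ∀ s, Function.Injective (mfderiv (𝓡 2) I φ s)
  range_deriv : ∀ s,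
    (mfderiv (𝓡 2) I φ s).toLinearMap.range = distributionΔ I f N (φ s)

end Hypersurface

section Sphere

variable {n : ℕ}

/-- The round sphere of centre `c` and radius `r` in the affine subspace `c + V`
(a 2-sphere if `V` has dimension three). -/
def roundSphere (V : Submodule ℝ (Ambient n)) (c : Ambient n) (r : ℝ) : Set (Ambient n) :=
  (AffineSubspace.mk' c V : Set (Ambient n)) ∩ Metric.sphere c r

/-- The orthonormal frame `e₁, …, eₙ₋₂` of the generator through the point of the sphere with
outward unit normal `q`. The vector with the distinguished index `i₀` is `-sin α q + cos α e`, where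
`e = e i₀`; the other vectors are the constant vectors `e i`. -/
def frame {V : Submodule ℝ (Ambient n)} (e : OrthonormalBasis (Fin (n - 2)) ℝ Vᗮ)
    (i₀ : Fin (n - 2)) (α : ℝ) (q : Metric.sphere (0 : V) 1) (i : Fin (n - 2)) : Ambient n :=
  if i = i₀ then -Real.sin α • ((q : V) : Ambient n) + Real.cos α • (e i₀ : Ambient n)
  else (e i : Ambient n)

/-- The hypersurface `(q, w) ↦ z + ∑ wⁱ eᵢ` generated by the sphere `z = c + r q`. -/
def generated {V : Submodule ℝ (Ambient n)} (c : Ambient n) (r : ℝ)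
    (e : OrthonormalBasis (Fin (n - 2)) ℝ Vᗮ) (i₀ : Fin (n - 2)) (α : ℝ)
    (x : Metric.sphere (0 : V) 1 × EuclideanSpace ℝ (Fin (n - 2))) : Ambient n :=
  c + r • ((x.1 : V) : Ambient n) + ∑ i, x.2 i • frame e i₀ α x.1 i

/-- The unit normal field `cos α q + sin α e` of the generated hypersurface. -/
def generatedNormal {V : Submodule ℝ (Ambient n)}
    (e : OrthonormalBasis (Fin (n - 2)) ℝ Vᗮ) (i₀ : Fin (n - 2)) (α : ℝ)
    (x : Metric.sphere (0 : V) 1 × EuclideanSpace ℝ (Fin (n - 2))) : Ambient n :=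
  Real.cos α • ((x.1 : V) : Ambient n) + Real.sin α • (e i₀ : Ambient n)

/-- The parameters at which the generated hypersurface is regular. -/
def regularSet (V : Submodule ℝ (Ambient n)) (r : ℝ) (i₀ : Fin (n - 2)) (α : ℝ) :
    Set (Metric.sphere (0 : V) 1 × EuclideanSpace ℝ (Fin (n - 2))) :=
  {x | r - x.2 i₀ * Real.sin α ≠ 0}

end Sphere

end BiUmbilical

end

/-!
Let `g = f ∘ φ` be an integral surface of the distribution `Δ`, and let `ξ = N ∘ φ` and `κ = ν ∘ φ`
be the normal field and the principal curvature along it. As `Δ` consists of eigenvectors,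
`dξ = -κ dg`. Symmetry of the second derivative of `ξ` and the rank two of `dg` give `dκ = 0`
(`IsLocalIntegralSurface.fderiv_curvature_comp`), so that `ξ + κ g` is constant as well and `g` lies
on a hypersphere.

That `g` lies in a three-dimensional affine space rests on the Codazzi equation of the hypersurface.
The third and second fundamental forms satisfy `III = ν II`; differentiating this identity
(`IsLocalBiUmbilical.codazzi_third_form`) shows that `g` is totally umbilical in the ambient space,
also in the directions of `ker A` (`IsLocalIntegralSurface.isLocalUmbilical`). Hence the osculating
spaces, spanned by the first and second derivatives of `g`, have dimension three. The Codazzi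
equation of a totally umbilical surface puts the third derivatives into the osculating space too
(`IsLocalUmbilical.thirdFDeriv_mem_range`), and a moving frame whose derivatives lie in its own span
has locally constant span (`eventually_range_eq`). To pass from charts to a connected surface, one
notes that for a vector `b` the set of points near which `⟪g, b⟫` is constant is open and closed
(`IsIntegralSurface.exists_roundSphere`). The round sphere is the intersection of the hypersphere
with the affine space.

Conversely, with `ρ = r - w¹ sin α`, the differential of the generated hypersurface is
`(s, t) ↦ ρ s + ∑ tⁱ eᵢ`, where `s` is tangent to the sphere at `q` and the two summands are
orthogonal, and that of the normal field is `(s, t) ↦ cos α s`. So the shape operator is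
`(s, t) ↦ (-(cos α / ρ) s, 0)` (`leftInverse_comp_apply`).
-/

noncomputable section

namespace BiUmbilical

open Filter Topology

/-! ### Derivatives of operator-valued maps -/

section Calculus

variable {E E₁ E₂ F : Type*} [NormedAddCommGroup E] [NormedSpace ℝ E]
  [NormedAddCommGroup E₁] [NormedSpace ℝ E₁] [NormedAddCommGroup E₂] [NormedSpace ℝ E₂]
  [NormedAddCommGroup F]

theorem fderiv_apply_const [NormedSpace ℝ F] {A : E → E₁ →L[ℝ] F} {x : E}
    (hA : DifferentiableAt ℝ A x) (u : E₁) (k : E) :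
    fderiv ℝ (fun y => A y u) x k = fderiv ℝ A x k u := by
  rw [fderiv_clm_apply hA (differentiableAt_const u)]
  simp

theorem fderiv_inner_apply_const [InnerProductSpace ℝ F] {A : E → E₁ →L[ℝ] F} {B : E → E₂ →L[ℝ] F}
    {x : E} (hA : DifferentiableAt ℝ A x) (hB : DifferentiableAt ℝ B x) (u : E₁) (v : E₂) (k : E) :
    fderiv ℝ (fun y => ⟪A y u, B y v⟫_ℝ) x k =
      ⟪A x u, fderiv ℝ B x k v⟫_ℝ + ⟪fderiv ℝ A x k u, B x v⟫_ℝ := by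
  rw [fderiv_inner_apply ℝ (hA.clm_apply (differentiableAt_const u))
    (hB.clm_apply (differentiableAt_const v)), fderiv_apply_const hA, fderiv_apply_const hB]

theorem differentiableAt_inner_apply_const [InnerProductSpace ℝ F] {A : E → E₁ →L[ℝ] F}
    {B : E → E₂ →L[ℝ] F} {x : E} (hA : DifferentiableAt ℝ A x) (hB : DifferentiableAt ℝ B x)
    (u : E₁) (v : E₂) : DifferentiableAt ℝ (fun y => ⟪A y u, B y v⟫_ℝ) x :=
  (hA.clm_apply (differentiableAt_const u)).inner ℝ (hB.clm_apply (differentiableAt_const v))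

theorem contDiffAt_fderiv [NormedSpace ℝ F] {f : E → F} {x : E} (hf : ContDiffAt ℝ ∞ f x) :
    ContDiffAt ℝ ∞ (fderiv ℝ f) x :=
  hf.fderiv_right (by simp)

theorem fderiv_fderiv_symm [NormedSpace ℝ F] {f : E → F} {x : E} (hf : ContDiffAt ℝ ∞ f x)
    (u v : E) : fderiv ℝ (fderiv ℝ f) x u v = fderiv ℝ (fderiv ℝ f) x v u :=
  (hf.isSymmSndFDerivAt (by
    simpa using WithTop.coe_le_coe.2 (le_top : (2 : ℕ∞) ≤ ⊤))) u v

theorem eventually_eq_of_fderiv_eq_zero [NormedSpace ℝ F] {f : E → F} {x : E}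
    (hd : ∀ᶠ y in 𝓝 x, DifferentiableAt ℝ f y) (h0 : ∀ᶠ y in 𝓝 x, fderiv ℝ f y = 0) :
    ∀ᶠ y in 𝓝 x, f y = f x := by
  obtain ⟨ε, hε, hb⟩ := Metric.eventually_nhds_iff_ball.1 (hd.and h0)
  filter_upwards [Metric.ball_mem_nhds x hε] with y hy
  exact Metric.isOpen_ball.is_const_of_fderiv_eq_zero (convex_ball x ε).isPreconnected
    (fun z hz => (hb z hz).1.differentiableWithinAt) (fun z hz => (hb z hz).2) hy
    (Metric.mem_ball_self hε)

end Calculus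

/-! ### The pointwise linear algebra of bi-umbilical hypersurfaces -/

section Pointwise

variable {E E' F : Type*} [NormedAddCommGroup F] [InnerProductSpace ℝ F]

/-- The pointwise linear algebra of a bi-umbilical hypersurface of type number two: `a` and `b` play
the roles of the differentials of the immersion and of its unit normal field `m`. The shape operator
does not occur; `b = -a ∘ A` is written out in terms of the principal vectors `X`, `Y`. -/
structure IsBiUmbilicalPair (a b : E → F) (m : F) (ν : ℝ) : Prop where
  ne_zero : ν ≠ 0
  injective : Function.Injective a
  norm_normal : ‖m‖ = 1
  inner_normal : ∀ v, ⟪m, a v⟫_ℝ = 0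
  exists_of_inner_normal : ∀ η, ⟪m, η⟫_ℝ = 0 → ∃ z, a z = η
  principal : ∃ X Y, ⟪a X, a X⟫_ℝ = 1 ∧ ⟪a Y, a Y⟫_ℝ = 1 ∧ ⟪a X, a Y⟫_ℝ = 0 ∧
    ∀ u, b u = -(ν • (⟪a u, a X⟫_ℝ • a X + ⟪a u, a Y⟫_ℝ • a Y))

namespace IsBiUmbilicalPair

theorem comp_bijective {a b : E → F} {m : F} {ν : ℝ} (h : IsBiUmbilicalPair a b m ν)
    {J : E' → E} (hJ : Function.Bijective J) : IsBiUmbilicalPair (a ∘ J) (b ∘ J) m ν where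
  ne_zero := h.ne_zero
  injective := h.injective.comp hJ.1
  norm_normal := h.norm_normal
  inner_normal v := h.inner_normal _
  exists_of_inner_normal η hη := by
    obtain ⟨z, rfl⟩ := h.exists_of_inner_normal η hη
    obtain ⟨z, rfl⟩ := hJ.2 z
    exact ⟨z, rfl⟩
  principal := by
    obtain ⟨X, Y, hX⟩ := h.principal
    obtain ⟨X, rfl⟩ := hJ.2 X
    obtain ⟨Y, rfl⟩ := hJ.2 Y
    exact ⟨X, Y, hX.1, hX.2.1, hX.2.2.1, fun u => hX.2.2.2 _⟩

theorem of_comp_bijective {a b : E → F} {m : F} {ν : ℝ} {J : E' → E} (hJ : Function.Bijective J)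
    (h : IsBiUmbilicalPair (a ∘ J) (b ∘ J) m ν) : IsBiUmbilicalPair a b m ν := by
  set e := Equiv.ofBijective J hJ
  have h' := h.comp_bijective e.symm.bijective
  have he : J ∘ e.symm = id := funext e.apply_symm_apply
  rwa [Function.comp_assoc, Function.comp_assoc, he, Function.comp_id, Function.comp_id] at h'

variable {a b : E → F} {m : F} {ν : ℝ}

theorem inner_third_form (h : IsBiUmbilicalPair a b m ν) (u v : E) :
    ⟪b u, b v⟫_ℝ + ν * ⟪b u, a v⟫_ℝ = 0 := by
  obtain ⟨X, Y, hX, hY, hXY, hb⟩ := h.principal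
  have hYX : ⟪a Y, a X⟫_ℝ = 0 := by rw [real_inner_comm, hXY]
  rw [hb u, hb v]
  simp only [inner_neg_left, inner_neg_right, inner_smul_left, inner_smul_right, inner_add_left,
    inner_add_right, hX, hY, hXY, hYX, RCLike.conj_to_real, real_inner_comm (a X) (a v),
    real_inner_comm (a Y) (a v)]
  rw [real_inner_comm (a v) (a X), real_inner_comm (a v) (a Y)]
  ring

theorem inner_symm (h : IsBiUmbilicalPair a b m ν) (u v : E) :
    ⟪b u, a v⟫_ℝ = ⟪a u, b v⟫_ℝ := by
  obtain ⟨X, Y, hX, hY, hXY, hb⟩ := h.principal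
  rw [hb u, hb v]
  simp only [inner_neg_left, inner_neg_right, inner_smul_left, inner_smul_right, inner_add_left,
    inner_add_right, RCLike.conj_to_real]
  rw [real_inner_comm (a v) (a X), real_inner_comm (a v) (a Y)]
  ring

theorem exists_inner_ne_zero (h : IsBiUmbilicalPair a b m ν) : ∃ w, ⟪b w, a w⟫_ℝ ≠ 0 := by
  obtain ⟨X, Y, hX, hY, hXY, hb⟩ := h.principal
  refine ⟨X, ?_⟩
  rw [hb X, hX, hXY, zero_smul, add_zero, one_smul, inner_neg_left, real_inner_smul_left, hX]
  simpa using h.ne_zero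

/-- The vectors orthogonal to the eigenspace of `ν` lie in the kernel of the shape operator. -/
theorem eq_zero_of_orthogonal (h : IsBiUmbilicalPair a b m ν) {z : E}
    (hz : ∀ v, b v = -(ν • a v) → ⟪a z, a v⟫_ℝ = 0) : b z = 0 := by
  obtain ⟨X, Y, hX, hY, hXY, hb⟩ := h.principal
  have hYX : ⟪a Y, a X⟫_ℝ = 0 := by rw [real_inner_comm, hXY]
  have h1 := hz X (by rw [hb X, hX, hXY]; simp)
  have h2 := hz Y (by rw [hb Y, hY, hYX]; simp)
  rw [hb z, h1, h2]; simp

end IsBiUmbilicalPair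

end Pointwise

/-! ### The Codazzi equation of a bi-umbilical hypersurface in coordinates -/

section LocalHypersurface

variable {E F : Type*} [NormedAddCommGroup E] [NormedSpace ℝ E]
  [NormedAddCommGroup F] [InnerProductSpace ℝ F]

/-- A bi-umbilical hypersurface of type number two in a coordinate domain `O`, with unit normal
field `N` and principal curvature function `ν`. -/
structure IsLocalBiUmbilical (O : Set E) (f N : E → F) (ν : E → ℝ) : Prop where
  isOpen : IsOpen O
  contDiffAt : ∀ y ∈ O, ContDiffAt ℝ ∞ f y
  normal_contDiffAt : ∀ y ∈ O, ContDiffAt ℝ ∞ N y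
  pair : ∀ y ∈ O, IsBiUmbilicalPair (fderiv ℝ f y) (fderiv ℝ N y) (N y) (ν y)

namespace IsLocalBiUmbilical

variable {O : Set E} {f N : E → F} {ν : E → ℝ}

theorem differentiableAt_fderiv (h : IsLocalBiUmbilical O f N ν) {y : E} (hy : y ∈ O) :
    DifferentiableAt ℝ (fderiv ℝ f) y :=
  (contDiffAt_fderiv (h.contDiffAt y hy)).differentiableAt (by simp)

theorem differentiableAt_fderiv_normal (h : IsLocalBiUmbilical O f N ν) {y : E} (hy : y ∈ O) :
    DifferentiableAt ℝ (fderiv ℝ N) y :=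
  (contDiffAt_fderiv (h.normal_contDiffAt y hy)).differentiableAt (by simp)

theorem differentiableAt_curvature (h : IsLocalBiUmbilical O f N ν) {y : E} (hy : y ∈ O) :
    DifferentiableAt ℝ ν y := by
  obtain ⟨w, hw⟩ := (h.pair y hy).exists_inner_ne_zero
  have hf := h.differentiableAt_fderiv hy
  have hN := h.differentiableAt_fderiv_normal hy
  have h1 := differentiableAt_inner_apply_const hN hN w w
  have h2 := differentiableAt_inner_apply_const hN hf w w
  refine (h1.neg.mul (h2.inv hw)).congr_of_eventuallyEq ?_
  filter_upwards [h.isOpen.mem_nhds hy, h2.continuousAt.eventually_ne hw] with x hx hx0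
  have := (h.pair x hx).inner_third_form w w
  simp only [Pi.mul_apply, Pi.inv_apply, Pi.neg_apply]
  rw [← div_eq_mul_inv, eq_div_iff hx0]
  linarith

/-- The Codazzi-type identity obtained by differentiating `III = ν II` and evaluating the result on
two vectors of the distribution. -/
theorem codazzi_third_form (h : IsLocalBiUmbilical O f N ν) {y : E} (hy : y ∈ O) {u v : E}
    (hu : fderiv ℝ N y u = -(ν y • fderiv ℝ f y u)) (hv : fderiv ℝ N y v = -(ν y • fderiv ℝ f y v))
    (x : E) :
    ⟪fderiv ℝ f y u, fderiv ℝ (fderiv ℝ N) y x v⟫_ℝ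
      + fderiv ℝ ν y x * ⟪fderiv ℝ f y u, fderiv ℝ f y v⟫_ℝ
      + ν y * ⟪fderiv ℝ f y u, fderiv ℝ (fderiv ℝ f) y x v⟫_ℝ = 0 := by
  have hf := h.differentiableAt_fderiv hy
  have hN := h.differentiableAt_fderiv_normal hy
  have hν := h.differentiableAt_curvature hy
  have h1 := differentiableAt_inner_apply_const hN hN u v
  have h2 := differentiableAt_inner_apply_const hN hf u v
  have key : (fun y => ⟪fderiv ℝ N y u, fderiv ℝ N y v⟫_ℝ
      + ν y * ⟪fderiv ℝ N y u, fderiv ℝ f y v⟫_ℝ) =ᶠ[𝓝 y] fun _ => 0 := by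
    filter_upwards [h.isOpen.mem_nhds hy] with x hx using (h.pair x hx).inner_third_form u v
  have := congrArg (fun L : E →L[ℝ] ℝ => L x) key.fderiv_eq
  rw [fderiv_fun_add h1 (hν.fun_mul h2), fderiv_fun_mul hν h2] at this
  simp only [add_apply, smul_apply, fderiv_inner_apply_const hN hN,
    fderiv_inner_apply_const hN hf, fderiv_fun_const, Pi.zero_apply, zero_apply,
    smul_eq_mul, hu, hv, inner_neg_left, inner_neg_right, inner_smul_left, inner_smul_right,
    RCLike.conj_to_real] at this
  have hne := (h.pair y hy).ne_zero
  apply mul_left_cancel₀ hne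
  linear_combination -this

/-- The second fundamental form of the distribution in the direction of a vector `z` of the
relative nullity distribution: it is a multiple of the metric. -/
theorem inner_sndFDeriv_normal (h : IsLocalBiUmbilical O f N ν) {y : E} (hy : y ∈ O) {u v z : E}
    (hu : fderiv ℝ N y u = -(ν y • fderiv ℝ f y u)) (hv : fderiv ℝ N y v = -(ν y • fderiv ℝ f y v))
    (hz : fderiv ℝ N y z = 0) :
    ⟪fderiv ℝ (fderiv ℝ N) y u v, fderiv ℝ f y z⟫_ℝ
      = -(fderiv ℝ ν y z) * ⟪fderiv ℝ f y u, fderiv ℝ f y v⟫_ℝ := by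
  have hf := h.differentiableAt_fderiv hy
  have hN := h.differentiableAt_fderiv_normal hy
  have key : (fun y => ⟪fderiv ℝ N y v, fderiv ℝ f y z⟫_ℝ)
      =ᶠ[𝓝 y] fun y => ⟪fderiv ℝ f y v, fderiv ℝ N y z⟫_ℝ := by
    filter_upwards [h.isOpen.mem_nhds hy] with x hx using (h.pair x hx).inner_symm v z
  have h1 := congrArg (fun L : E →L[ℝ] ℝ => L u) key.fderiv_eq
  simp only [fderiv_inner_apply_const hN hf, fderiv_inner_apply_const hf hN, hz, hv,
    inner_zero_right, inner_neg_left, inner_smul_left, RCLike.conj_to_real] at h1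
  have h2 := h.codazzi_third_form hy hv hu z
  rw [fderiv_fderiv_symm (h.normal_contDiffAt y hy) z u,
    fderiv_fderiv_symm (h.contDiffAt y hy) z u] at h2
  rw [real_inner_comm (fderiv ℝ f y v) (fderiv ℝ f y u)]
  linarith

end IsLocalBiUmbilical

end LocalHypersurface

/-! ### Moving frames -/

section MovingFrames

variable {X K F : Type*} [NormedAddCommGroup X] [NormedSpace ℝ X]
  [NormedAddCommGroup K] [NormedSpace ℝ K] [FiniteDimensional ℝ K]
  [NormedAddCommGroup F] [NormedSpace ℝ F] [FiniteDimensional ℝ F]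

/-- A frame `B` which is injective at `x₀` can be normalized near `x₀`: for a left inverse `L` of
`B x₀`, the frame `B x ∘ (L ∘ B x)⁻¹` has the same range as `B x` and is a section of `L`. -/
theorem exists_frame_normalization {B : X → K →L[ℝ] F} {x₀ : X}
    (hB : ∀ᶠ x in 𝓝 x₀, DifferentiableAt ℝ B x) (hinj : Function.Injective (B x₀)) :
    ∃ (L : F →L[ℝ] K) (R : X → K →L[ℝ] K), ∀ᶠ x in 𝓝 x₀, DifferentiableAt ℝ R x ∧
      (∀ t, L (B x (R x t)) = t) ∧ ∀ t, R x (L (B x t)) = t := by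
  have : CompleteSpace K := FiniteDimensional.complete ℝ K
  obtain ⟨L₀, hL₀⟩ := (B x₀).toLinearMap.exists_leftInverse_of_injective
    (LinearMap.ker_eq_bot.2 hinj)
  set L : F →L[ℝ] K := L₀.toContinuousLinearMap with hL
  have hM : ∀ᶠ x in 𝓝 x₀, DifferentiableAt ℝ (fun x => L ∘L B x) x := by
    filter_upwards [hB] with x hx using (differentiableAt_const L).clm_comp hx
  have h0 : L ∘L B x₀ = 1 := by
    ext t
    exact LinearMap.congr_fun hL₀ t
  have hunit : ∀ᶠ x in 𝓝 x₀, IsUnit (L ∘L B x) := by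
    refine hM.self_of_nhds.continuousAt.eventually (Units.isOpen.mem_nhds ?_)
    simp [h0]
  refine ⟨L, fun x => Ring.inverse (L ∘L B x), ?_⟩
  filter_upwards [hM, hunit] with x hx hu
  refine ⟨hx.inverse hu, fun t => ?_, fun t => ?_⟩
  · exact congrArg (fun T : K →L[ℝ] K => T t) (Ring.mul_inverse_cancel _ hu)
  · exact congrArg (fun T : K →L[ℝ] K => T t) (Ring.inverse_mul_cancel _ hu)

/-- The derivative of a vector field with values in the span of a moving frame. -/
theorem exists_fderiv_eq_of_mem_range {B : X → K →L[ℝ] F} {Q : X → F} {x₀ : X}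
    (hB : ∀ᶠ x in 𝓝 x₀, DifferentiableAt ℝ B x) (hinj : Function.Injective (B x₀))
    (hQ : DifferentiableAt ℝ Q x₀) (hmem : ∀ᶠ x in 𝓝 x₀, Q x ∈ Set.range (B x)) :
    ∃ w : K, ∀ k, ∃ w', fderiv ℝ Q x₀ k = fderiv ℝ B x₀ k w + B x₀ w' := by
  obtain ⟨L, R, hR⟩ := exists_frame_normalization hB hinj
  have hw : DifferentiableAt ℝ (fun x => R x (L (Q x))) x₀ :=
    hR.self_of_nhds.1.clm_apply (L.differentiableAt.comp x₀ hQ)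
  have hev : Q =ᶠ[𝓝 x₀] fun x => B x (R x (L (Q x))) := by
    filter_upwards [hR, hmem] with x hx hxm
    obtain ⟨t, ht⟩ := hxm
    rw [← ht, hx.2.2]
  refine ⟨R x₀ (L (Q x₀)), fun k => ⟨fderiv ℝ (fun x => R x (L (Q x))) x₀ k, ?_⟩⟩
  rw [hev.fderiv_eq, fderiv_clm_apply hB.self_of_nhds hw]
  simp [add_comm]

/-- A moving frame whose derivatives lie in its own span has locally constant span: the normalized
frame is a section of the fixed map `L`, so its derivative is zero. -/
theorem eventually_range_eq {B : X → K →L[ℝ] F} {x₀ : X}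
    (hB : ∀ᶠ x in 𝓝 x₀, DifferentiableAt ℝ B x) (hinj : Function.Injective (B x₀))
    (hmem : ∀ᶠ x in 𝓝 x₀, ∀ k v, fderiv ℝ B x k v ∈ Set.range (B x)) :
    ∀ᶠ x in 𝓝 x₀, (B x).range = (B x₀).range := by
  obtain ⟨L, R, hR⟩ := exists_frame_normalization hB hinj
  have hC : ∀ᶠ x in 𝓝 x₀, DifferentiableAt ℝ (fun x => B x ∘L R x) x := by
    filter_upwards [hB, hR] with x hx hx' using hx.clm_comp hx'.1
  have hC0 : ∀ᶠ x in 𝓝 x₀, fderiv ℝ (fun x => B x ∘L R x) x = 0 := by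
    filter_upwards [hB, hR, hmem, hR.eventually_nhds, hC] with x hBx hRx hmx hRx' hCx
    ext k v
    have h1 : fderiv ℝ (fun x => B x ∘L R x) x k v
        = B x (fderiv ℝ R x k v) + fderiv ℝ B x k (R x v) := by
      rw [fderiv_clm_comp hBx hRx.1]
      simp
    obtain ⟨t, ht⟩ := hmx k (R x v)
    have h2 : L (fderiv ℝ (fun x => B x ∘L R x) x k v) = 0 := by
      have h3 : (fun y => L ((B y ∘L R y) v)) =ᶠ[𝓝 x] fun _ => v := by
        filter_upwards [hRx'] with y hy using hy.2.1 v
      have h4 := congrArg (fun T : X →L[ℝ] K => T k) h3.fderiv_eq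
      simp only [fderiv_fun_const, Pi.zero_apply, zero_apply] at h4
      have h5 : HasFDerivAt (fun y => L ((B y ∘L R y) v))
          (L ∘L (fderiv ℝ (fun y => (B y ∘L R y) v) x)) x :=
        L.hasFDerivAt.comp x (hCx.clm_apply (differentiableAt_const v)).hasFDerivAt
      rw [h5.fderiv] at h4
      rw [← fderiv_apply_const hCx v k]
      exact h4
    have h6 : fderiv ℝ (fun x => B x ∘L R x) x k v = B x (fderiv ℝ R x k v + t) := by
      rw [h1, ← ht, map_add]
    rw [h6] at h2 ⊢
    rw [← hRx.2.2 (fderiv ℝ R x k v + t), h2]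
    simp
  filter_upwards [eventually_eq_of_fderiv_eq_zero hC hC0, hR] with x hx hRx
  have hrange : ∀ y, (∀ t, R y (L (B y t)) = t) → (B y).range = (B y ∘L R y).range := by
    intro y hy
    apply le_antisymm
    · rintro _ ⟨t, rfl⟩
      exact ⟨L (B y t), by simp [hy]⟩
    · rintro _ ⟨t, rfl⟩
      exact ⟨R y t, rfl⟩
  rw [hrange x hRx.2.2, hrange x₀ hR.self_of_nhds.2.2, hx]

end MovingFrames

/-! ### Totally umbilical surfaces in coordinates -/

section UmbilicalSurface

variable {G F : Type*} [NormedAddCommGroup G] [NormedSpace ℝ G]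
  [NormedAddCommGroup F] [InnerProductSpace ℝ F]

/-- A totally umbilical immersion `g` of a coordinate domain `D` without flat points: the second
fundamental form in each normal direction is a multiple of the metric, and it is nonzero in some
normal direction. Tangential components of the second derivative drop out of the pairing with a
normal vector, so no connection is needed. -/
structure IsLocalUmbilical (D : Set G) (g : G → F) : Prop where
  isOpen : IsOpen D
  contDiffAt : ∀ x ∈ D, ContDiffAt ℝ ∞ g x
  injective : ∀ x ∈ D, Function.Injective (fderiv ℝ g x)
  umbilical : ∀ x ∈ D, ∀ η, (∀ u, ⟪fderiv ℝ g x u, η⟫_ℝ = 0) → ∃ c : ℝ, ∀ u v,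
    ⟪fderiv ℝ (fderiv ℝ g) x u v, η⟫_ℝ = c * ⟪fderiv ℝ g x u, fderiv ℝ g x v⟫_ℝ
  nonflat : ∀ x ∈ D, ∃ η, (∀ u, ⟪fderiv ℝ g x u, η⟫_ℝ = 0) ∧ ∃ c : ℝ, c ≠ 0 ∧ ∀ u v,
    ⟪fderiv ℝ (fderiv ℝ g) x u v, η⟫_ℝ = c * ⟪fderiv ℝ g x u, fderiv ℝ g x v⟫_ℝ

/-- The frame of the osculating space of `g` given by the differential of `g` and the second
derivative of `g` in the direction `e`. -/
def osculatingFrame (g : G → F) (e : G) (x : G) : G × ℝ →L[ℝ] F :=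
  fderiv ℝ g x ∘L ContinuousLinearMap.fst ℝ G ℝ
    + (ContinuousLinearMap.snd ℝ G ℝ).smulRight (fderiv ℝ (fderiv ℝ g) x e e)

@[simp]
theorem osculatingFrame_apply (g : G → F) (e x v : G) (t : ℝ) :
    osculatingFrame g e x (v, t) = fderiv ℝ g x v + t • fderiv ℝ (fderiv ℝ g) x e e := by
  simp [osculatingFrame]

theorem contDiffAt_osculatingFrame {g : G → F} {x : G} (hg : ContDiffAt ℝ ∞ g x) (e : G) :
    ContDiffAt ℝ ∞ (osculatingFrame g e) x := by
  have h1 := contDiffAt_fderiv hg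
  have h2 := contDiffAt_fderiv h1
  have h3 : ContDiffAt ℝ ∞ (fun y => fderiv ℝ (fderiv ℝ g) y e e) x :=
    (h2.clm_apply contDiffAt_const).clm_apply contDiffAt_const
  exact (h1.clm_comp contDiffAt_const).add (contDiffAt_const.smulRight h3)

theorem fderiv_osculatingFrame {g : G → F} {x : G} (hg : ContDiffAt ℝ ∞ g x) (e k v : G) (t : ℝ) :
    fderiv ℝ (osculatingFrame g e) x k (v, t) = fderiv ℝ (fderiv ℝ g) x k v
      + t • fderiv ℝ (fderiv ℝ (fderiv ℝ g)) x k e e := by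
  have h1 := contDiffAt_fderiv hg
  have h2 := contDiffAt_fderiv h1
  have d1 := h1.differentiableAt (by simp)
  have d2 := h2.differentiableAt (by simp)
  have d3 := d2.clm_apply (differentiableAt_const e)
  rw [← fderiv_apply_const ((contDiffAt_osculatingFrame hg e).differentiableAt (by simp))]
  simp only [osculatingFrame_apply]
  rw [fderiv_fun_add (d1.clm_apply (differentiableAt_const v))
    ((d3.clm_apply (differentiableAt_const e)).fun_const_smul t),
    fderiv_fun_const_smul (d3.clm_apply (differentiableAt_const e)) t]
  simp only [add_apply, smul_apply]
  rw [fderiv_apply_const d1, fderiv_apply_const d3, fderiv_apply_const d2]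

theorem fderiv_fderiv_fderiv_symm_left {g : G → F} {x : G} (hg : ContDiffAt ℝ ∞ g x) (k u v : G) :
    fderiv ℝ (fderiv ℝ (fderiv ℝ g)) x k u v = fderiv ℝ (fderiv ℝ (fderiv ℝ g)) x u k v := by
  rw [fderiv_fderiv_symm (contDiffAt_fderiv hg)]

theorem fderiv_fderiv_fderiv_symm_right {g : G → F} {x : G}
    (hg : ∀ᶠ y in 𝓝 x, ContDiffAt ℝ ∞ g y) (k u v : G) :
    fderiv ℝ (fderiv ℝ (fderiv ℝ g)) x k u v = fderiv ℝ (fderiv ℝ (fderiv ℝ g)) x k v u := by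
  have d2 := (contDiffAt_fderiv (contDiffAt_fderiv hg.self_of_nhds)).differentiableAt (by simp)
  have key : (fun y => fderiv ℝ (fderiv ℝ g) y u v)
      =ᶠ[𝓝 x] fun y => fderiv ℝ (fderiv ℝ g) y v u := by
    filter_upwards [hg] with y hy using fderiv_fderiv_symm hy u v
  have := congrArg (fun T : G →L[ℝ] F => T k) key.fderiv_eq
  rwa [fderiv_apply_const (d2.clm_apply (differentiableAt_const u)), fderiv_apply_const d2,
    fderiv_apply_const (d2.clm_apply (differentiableAt_const v)), fderiv_apply_const d2] at this

namespace IsLocalUmbilical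

variable {D : Set G} {g : G → F}

theorem inner_self_ne_zero (h : IsLocalUmbilical D g) {x : G} (hx : x ∈ D) {e : G} (he : e ≠ 0) :
    ⟪fderiv ℝ g x e, fderiv ℝ g x e⟫_ℝ ≠ 0 := by
  rw [_root_.inner_self_ne_zero]
  exact fun h0 => he (h.injective x hx (by rw [h0, map_zero]))

theorem injective_osculatingFrame (h : IsLocalUmbilical D g) {x : G} (hx : x ∈ D) {e : G}
    (he : e ≠ 0) : Function.Injective (osculatingFrame g e x) := by
  rw [injective_iff_map_eq_zero]
  rintro ⟨v, t⟩ hvt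
  rw [osculatingFrame_apply] at hvt
  obtain ⟨η, hη, c, hc, hηc⟩ := h.nonflat x hx
  have h1 := congrArg (fun y => ⟪y, η⟫_ℝ) hvt
  simp only [inner_add_left, hη, real_inner_smul_left, hηc, inner_zero_left, zero_add] at h1
  have ht : t = 0 := 
    (mul_eq_zero.1 h1).resolve_right (mul_ne_zero hc (h.inner_self_ne_zero hx he))
  subst ht
  rw [zero_smul, add_zero] at hvt
  have hv : v = 0 := h.injective x hx (by rw [hvt, map_zero])
  rw [hv]
  rfl

variable [FiniteDimensional ℝ F]

/-- Umbilicity without reference to normal vectors. -/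
theorem mem_range_fderiv (h : IsLocalUmbilical D g) {x : G} (hx : x ∈ D) (u v u' v' : G) :
    ⟪fderiv ℝ g x u', fderiv ℝ g x v'⟫_ℝ • fderiv ℝ (fderiv ℝ g) x u v
      - ⟪fderiv ℝ g x u, fderiv ℝ g x v⟫_ℝ • fderiv ℝ (fderiv ℝ g) x u' v'
      ∈ Set.range (fderiv ℝ g x) := by
  change _ ∈ (fderiv ℝ g x).range
  rw [← Submodule.orthogonal_orthogonal (fderiv ℝ g x).range, Submodule.mem_orthogonal']
  intro η hη
  rw [Submodule.mem_orthogonal] at hη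
  obtain ⟨c, hc⟩ := h.umbilical x hx η fun u => hη _ ⟨u, rfl⟩
  rw [inner_sub_left, real_inner_smul_left, real_inner_smul_left, hc, hc]
  ring

theorem sndFDeriv_mem_range (h : IsLocalUmbilical D g) {x : G} (hx : x ∈ D) {e : G}
    (he : e ≠ 0) (u v : G) :
    fderiv ℝ (fderiv ℝ g) x u v ∈ (osculatingFrame g e x).range := by
  obtain ⟨w, hw⟩ := h.mem_range_fderiv hx u v e e
  have h0 := h.inner_self_ne_zero hx he
  rw [← Submodule.smul_mem_iff _ h0, ← sub_add_cancel (_ • fderiv ℝ (fderiv ℝ g) x u v)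
    (⟪fderiv ℝ g x u, fderiv ℝ g x v⟫_ℝ • fderiv ℝ (fderiv ℝ g) x e e), ← hw]
  exact ⟨(w, ⟪fderiv ℝ g x u, fderiv ℝ g x v⟫_ℝ), osculatingFrame_apply _ _ _ _ _⟩

variable [FiniteDimensional ℝ G]

/-- The Codazzi equation of a totally umbilical surface, modulo the osculating space. -/
theorem codazzi_mem_range (h : IsLocalUmbilical D g) {x : G} (hx : x ∈ D) {e : G}
    (he : e ≠ 0) (k u v u' v' : G) :
    ⟪fderiv ℝ g x u', fderiv ℝ g x v'⟫_ℝ • fderiv ℝ (fderiv ℝ (fderiv ℝ g)) x k u v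
      - ⟪fderiv ℝ g x u, fderiv ℝ g x v⟫_ℝ • fderiv ℝ (fderiv ℝ (fderiv ℝ g)) x k u' v'
      ∈ (osculatingFrame g e x).range := by
  have hg := h.contDiffAt x hx
  have d1 := (contDiffAt_fderiv hg).differentiableAt (by simp)
  have d2 := (contDiffAt_fderiv (contDiffAt_fderiv hg)).differentiableAt (by simp)
  have dd : ∀ u v, DifferentiableAt ℝ (fun y => fderiv ℝ (fderiv ℝ g) y u v) x := fun u v =>
    (d2.clm_apply (differentiableAt_const u)).clm_apply (differentiableAt_const v)
  have di : ∀ u v, DifferentiableAt ℝ (fun y => ⟪fderiv ℝ g y u, fderiv ℝ g y v⟫_ℝ) x :=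
    fun u v => differentiableAt_inner_apply_const d1 d1 u v
  have hf : ∀ u v, fderiv ℝ (fun y => fderiv ℝ (fderiv ℝ g) y u v) x k
      = fderiv ℝ (fderiv ℝ (fderiv ℝ g)) x k u v := fun u v => by
    rw [fderiv_apply_const (d2.clm_apply (differentiableAt_const u)), fderiv_apply_const d2]
  have hnear := h.isOpen.mem_nhds hx
  obtain ⟨w, hw⟩ := exists_fderiv_eq_of_mem_range (B := fderiv ℝ g)
    (Q := fun y => ⟪fderiv ℝ g y u', fderiv ℝ g y v'⟫_ℝ • fderiv ℝ (fderiv ℝ g) y u v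
      - ⟪fderiv ℝ g y u, fderiv ℝ g y v⟫_ℝ • fderiv ℝ (fderiv ℝ g) y u' v')
    (by filter_upwards [hnear] with y hy using
        (contDiffAt_fderiv (h.contDiffAt y hy)).differentiableAt (by simp))
    (h.injective x hx) (((di _ _).smul (dd _ _)).sub ((di _ _).smul (dd _ _)))
    (by filter_upwards [hnear] with y hy using h.mem_range_fderiv hy u v u' v')
  obtain ⟨w', hw'⟩ := hw k
  rw [fderiv_fun_sub ((di _ _).fun_smul (dd _ _)) ((di _ _).fun_smul (dd _ _)),
    fderiv_fun_smul (di _ _) (dd _ _), fderiv_fun_smul (di _ _) (dd _ _)] at hw'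
  simp only [sub_apply, add_apply, smul_apply, ContinuousLinearMap.smulRight_apply, hf] at hw'
  set W := (osculatingFrame g e x).range
  have h1 : ∀ w, fderiv ℝ g x w ∈ W := fun w =>
    ⟨(w, 0), by rw [ContinuousLinearMap.coe_coe, osculatingFrame_apply, zero_smul, add_zero]⟩
  have h2 := h.sndFDeriv_mem_range hx he
  have h3 := W.sub_mem (W.add_mem (W.add_mem (h2 k w) (h1 w'))
    (W.smul_mem (fderiv ℝ (fun y => ⟪fderiv ℝ g y u, fderiv ℝ g y v⟫_ℝ) x k) (h2 u' v')))
    (W.smul_mem (fderiv ℝ (fun y => ⟪fderiv ℝ g y u', fderiv ℝ g y v'⟫_ℝ) x k) (h2 u v))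
  rw [← hw'] at h3
  convert h3 using 1
  abel

/-- In dimension two, an orthogonal basis turns the Codazzi equation into the statement that the
osculating space contains the third derivatives. -/
theorem thirdFDeriv_mem_range (h : IsLocalUmbilical D g) (hG : Module.finrank ℝ G = 2) {x : G}
    (hx : x ∈ D) {e : G} (he : e ≠ 0) (k : G) :
    fderiv ℝ (fderiv ℝ (fderiv ℝ g)) x k e e ∈ (osculatingFrame g e x).range := by
  set W := (osculatingFrame g e x).range with hW
  have hg := h.contDiffAt x hx
  have hgn : ∀ᶠ y in 𝓝 x, ContDiffAt ℝ ∞ g y := by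
    filter_upwards [h.isOpen.mem_nhds hx] with y hy using h.contDiffAt y hy
  -- a nonzero vector `e'` orthogonal to `e` in the induced metric
  obtain ⟨e', he'mem, he'⟩ := (Submodule.ne_bot_iff _).1
    (LinearMap.ker_ne_bot_of_finrank_lt
      (f := (innerSL ℝ (fderiv ℝ g x e) ∘L fderiv ℝ g x).toLinearMap) (by simp [hG]))
  have horth : ⟪fderiv ℝ g x e, fderiv ℝ g x e'⟫_ℝ = 0 := he'mem
  have hee := h.inner_self_ne_zero hx he
  have hee' := h.inner_self_ne_zero hx he'
  have hcod := h.codazzi_mem_range hx he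
  have h1 : ∀ k, fderiv ℝ (fderiv ℝ (fderiv ℝ g)) x k e e' ∈ W := fun k => by
    have := hcod k e e' e e
    rwa [horth, zero_smul, sub_zero, Submodule.smul_mem_iff _ hee] at this
  have h2 : fderiv ℝ (fderiv ℝ (fderiv ℝ g)) x e' e e ∈ W := by
    rw [fderiv_fderiv_fderiv_symm_left hg, fderiv_fderiv_fderiv_symm_right hgn]
    exact h1 e
  have h3 : fderiv ℝ (fderiv ℝ (fderiv ℝ g)) x e e e ∈ W := by
    have h4 := hcod e e e e' e'
    have h5 : fderiv ℝ (fderiv ℝ (fderiv ℝ g)) x e e' e' ∈ W := by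
      rw [fderiv_fderiv_fderiv_symm_left hg]
      exact h1 e'
    rwa [Submodule.sub_mem_iff_left _ (W.smul_mem _ h5), Submodule.smul_mem_iff _ hee'] at h4
  have hli : LinearIndependent ℝ ![e, e'] := by
    rw [LinearIndependent.pair_iff]
    intro s t hst
    have hs := congrArg (fun y => ⟪fderiv ℝ g x e, fderiv ℝ g x y⟫_ℝ) hst
    simp only [map_add, map_smul, inner_add_right, real_inner_smul_right, horth, map_zero,
      inner_zero_right, mul_zero, add_zero, mul_eq_zero, hee, or_false] at hs
    subst hs
    rw [zero_smul, zero_add, smul_eq_zero] at hst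
    exact ⟨rfl, hst.resolve_right he'⟩
  have hspan := hli.span_eq_top_of_card_eq_finrank (by simp [hG])
  have hk : k ∈ Submodule.span ℝ (Set.range ![e, e']) := by rw [hspan]; trivial
  rw [Matrix.range_cons_cons_empty, Submodule.mem_span_pair] at hk
  obtain ⟨s, t, rfl⟩ := hk
  simp only [map_add, map_smul, add_apply, smul_apply]
  exact W.add_mem (W.smul_mem _ h3) (W.smul_mem _ h2)

/-- A totally umbilical surface without flat points lies locally in a three-dimensional affine
space, and `Vᗮ` consists precisely of the vectors `b` for which `⟪g, b⟫` is locally constant (near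
any point of a neighbourhood of `x₀`). -/
theorem exists_osculatingSpace (h : IsLocalUmbilical D g) (hG : Module.finrank ℝ G = 2) {x₀ : G}
    (hx₀ : x₀ ∈ D) :
    ∃ V : Submodule ℝ F, Module.finrank ℝ V = 3 ∧ ∀ᶠ x in 𝓝 x₀, ∀ b, b ∈ Vᗮ ↔
      ∀ᶠ y in 𝓝 x, ⟪g y, b⟫_ℝ = ⟪g x, b⟫_ℝ := by
  have : Nontrivial G := Module.nontrivial_of_finrank_pos (R := ℝ) (by omega)
  obtain ⟨e, he⟩ := exists_ne (0 : G)
  have hinj := h.injective_osculatingFrame hx₀ he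
  have hnear : ∀ᶠ x in 𝓝 x₀, x ∈ D := h.isOpen.mem_nhds hx₀
  have hrange := eventually_range_eq (B := osculatingFrame g e) (x₀ := x₀)
    (by filter_upwards [hnear] with x hx using
      (contDiffAt_osculatingFrame (h.contDiffAt x hx) e).differentiableAt (by simp)) hinj
    (by
      filter_upwards [hnear] with x hx
      rintro k ⟨v, t⟩
      rw [fderiv_osculatingFrame (h.contDiffAt x hx)]
      exact Submodule.add_mem _ (h.sndFDeriv_mem_range hx he k v)
        (Submodule.smul_mem _ t (h.thirdFDeriv_mem_range hG hx he k)))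
  refine ⟨(osculatingFrame g e x₀).range, ?_, ?_⟩
  · rw [LinearMap.finrank_range_of_inj hinj, Module.finrank_prod, hG, Module.finrank_self]
  have hdiff : ∀ b, ∀ x ∈ D, HasFDerivAt (fun y => ⟪g y, b⟫_ℝ)
      (innerSL ℝ b ∘L fderiv ℝ g x) x := fun b x hx => by
    have := (innerSL ℝ b).hasFDerivAt.comp x
      ((h.contDiffAt x hx).differentiableAt (by simp)).hasFDerivAt
    refine this.congr_of_eventuallyEq (Eventually.of_forall fun y => ?_)
    simp [real_inner_comm]
  filter_upwards [hnear.eventually_nhds, hrange.eventually_nhds] with x hxD hxr b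
  constructor
  · intro hb
    refine eventually_eq_of_fderiv_eq_zero ?_ ?_
    · filter_upwards [hxD] with y hy using (hdiff b y hy).differentiableAt
    · filter_upwards [hxD, hxr] with y hy hyr
      rw [(hdiff b y hy).fderiv]
      ext k
      refine Submodule.inner_left_of_mem_orthogonal (K := (osculatingFrame g e x₀).range) ?_ hb
      rw [← hyr]
      exact ⟨(k, 0), by simp⟩
  · intro hb
    have h1 : ∀ᶠ y in 𝓝 x, ∀ k, ⟪fderiv ℝ g y k, b⟫_ℝ = 0 := by
      filter_upwards [hb.eventually_nhds, hxD] with y hy hyD k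
      have hc : (fun z => ⟪g z, b⟫_ℝ) =ᶠ[𝓝 y] fun _ => ⟪g x, b⟫_ℝ := hy
      have h2 := congrArg (fun T : G →L[ℝ] ℝ => T k) hc.fderiv_eq
      rw [(hdiff b y hyD).fderiv] at h2
      rw [real_inner_comm]
      simpa using h2
    have d1 := (contDiffAt_fderiv (h.contDiffAt x hxD.self_of_nhds)).differentiableAt (by simp)
    have h2 : ⟪fderiv ℝ (fderiv ℝ g) x e e, b⟫_ℝ = 0 := by
      have hc : (fun y => ⟪fderiv ℝ g y e, b⟫_ℝ) =ᶠ[𝓝 x] fun _ => 0 := by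
        filter_upwards [h1] with y hy using hy e
      have h3 := congrArg (fun T : G →L[ℝ] ℝ => T e) hc.fderiv_eq
      simp only [fderiv_fun_const, Pi.zero_apply, zero_apply] at h3
      rw [fderiv_inner_apply ℝ (d1.clm_apply (differentiableAt_const e))
        (differentiableAt_const b), fderiv_apply_const d1] at h3
      simpa using h3
    rw [← hxr.self_of_nhds, Submodule.mem_orthogonal]
    rintro _ ⟨⟨v, t⟩, rfl⟩
    rw [ContinuousLinearMap.coe_coe, osculatingFrame_apply, inner_add_left, real_inner_smul_left,
      h1.self_of_nhds v, h2]
    simp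

end IsLocalUmbilical

end UmbilicalSurface

/-! ### Integral surfaces in coordinates -/

section LocalIntegralSurface

variable {E G F : Type*} [NormedAddCommGroup E] [NormedSpace ℝ E]
  [NormedAddCommGroup G] [NormedSpace ℝ G] [NormedAddCommGroup F] [InnerProductSpace ℝ F]

/-- A parametrized integral surface `φ`, defined on a coordinate domain `D`, of the distribution `Δ`
of a bi-umbilical hypersurface given in a coordinate domain `O`. -/
structure IsLocalIntegralSurface (O : Set E) (f N : E → F) (ν : E → ℝ) (D : Set G) (φ : G → E) :
    Prop where
  hypersurface : IsLocalBiUmbilical O f N ν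
  isOpen : IsOpen D
  mem : ∀ x ∈ D, φ x ∈ O
  contDiffAt : ∀ x ∈ D, ContDiffAt ℝ ∞ φ x
  injective : ∀ x ∈ D, Function.Injective (fderiv ℝ φ x)
  mem_range_iff : ∀ x ∈ D, ∀ v, v ∈ Set.range (fderiv ℝ φ x) ↔
    fderiv ℝ N (φ x) v = -(ν (φ x) • fderiv ℝ f (φ x) v)

namespace IsLocalIntegralSurface

variable {O : Set E} {f N : E → F} {ν : E → ℝ} {D : Set G} {φ : G → E}

theorem contDiffAt_comp (h : IsLocalIntegralSurface O f N ν D φ) {x : G} (hx : x ∈ D) :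
    ContDiffAt ℝ ∞ (f ∘ φ) x :=
  (h.hypersurface.contDiffAt _ (h.mem x hx)).comp x (h.contDiffAt x hx)

theorem contDiffAt_normal_comp (h : IsLocalIntegralSurface O f N ν D φ) {x : G} (hx : x ∈ D) :
    ContDiffAt ℝ ∞ (N ∘ φ) x :=
  (h.hypersurface.normal_contDiffAt _ (h.mem x hx)).comp x (h.contDiffAt x hx)

theorem fderiv_comp (h : IsLocalIntegralSurface O f N ν D φ) {x : G} (hx : x ∈ D) (v : G) :
    fderiv ℝ (f ∘ φ) x v = fderiv ℝ f (φ x) (fderiv ℝ φ x v) := by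
  rw [_root_.fderiv_comp x ((h.hypersurface.contDiffAt _ (h.mem x hx)).differentiableAt (by simp))
    ((h.contDiffAt x hx).differentiableAt (by simp))]
  rfl

theorem fderiv_normal_comp (h : IsLocalIntegralSurface O f N ν D φ) {x : G} (hx : x ∈ D) (v : G) :
    fderiv ℝ (N ∘ φ) x v = fderiv ℝ N (φ x) (fderiv ℝ φ x v) := by
  rw [_root_.fderiv_comp x
    ((h.hypersurface.normal_contDiffAt _ (h.mem x hx)).differentiableAt (by simp))
    ((h.contDiffAt x hx).differentiableAt (by simp))]
  rfl

theorem fderiv_normal_comp_eq (h : IsLocalIntegralSurface O f N ν D φ) {x : G} (hx : x ∈ D)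
    (v : G) : fderiv ℝ (N ∘ φ) x v = -(ν (φ x) • fderiv ℝ (f ∘ φ) x v) := by
  rw [h.fderiv_normal_comp hx, h.fderiv_comp hx, (h.mem_range_iff x hx _).1 ⟨v, rfl⟩]

theorem differentiableAt_curvature_comp (h : IsLocalIntegralSurface O f N ν D φ) {x : G}
    (hx : x ∈ D) : DifferentiableAt ℝ (ν ∘ φ) x :=
  (h.hypersurface.differentiableAt_curvature (h.mem x hx)).comp x
    ((h.contDiffAt x hx).differentiableAt (by simp))

theorem sndFDeriv_normal_comp_curvature (h : IsLocalIntegralSurface O f N ν D φ) {x : G}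
    (hx : x ∈ D) (u v : G) : fderiv ℝ (fderiv ℝ (N ∘ φ)) x u v =
      -(ν (φ x) • fderiv ℝ (fderiv ℝ (f ∘ φ)) x u v
        + fderiv ℝ (ν ∘ φ) x u • fderiv ℝ (f ∘ φ) x v) := by
  have d1 := (contDiffAt_fderiv (h.contDiffAt_comp hx)).differentiableAt (by simp)
  have d2 := (contDiffAt_fderiv (h.contDiffAt_normal_comp hx)).differentiableAt (by simp)
  have hκ := h.differentiableAt_curvature_comp hx
  have key : (fun y => fderiv ℝ (N ∘ φ) y v)
      =ᶠ[𝓝 x] fun y => -((ν ∘ φ) y • fderiv ℝ (f ∘ φ) y v) := by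
    filter_upwards [h.isOpen.mem_nhds hx] with y hy using h.fderiv_normal_comp_eq hy v
  have := congrArg (fun T : G →L[ℝ] F => T u) key.fderiv_eq
  rw [fderiv_apply_const d2, fderiv_fun_neg,
    fderiv_fun_smul hκ (d1.clm_apply (differentiableAt_const v))] at this
  simpa [fderiv_apply_const d1] using this

/-- The principal curvature is constant along an integral surface: the right-hand side of
`dξ = -κ dg` is closed and the differential `dg` has rank two. -/
theorem fderiv_curvature_comp (h : IsLocalIntegralSurface O f N ν D φ)
    (hG : Module.finrank ℝ G = 2) {x : G} (hx : x ∈ D) : fderiv ℝ (ν ∘ φ) x = 0 := by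
  have : FiniteDimensional ℝ G := .of_finrank_pos (by omega)
  obtain ⟨v, hv, hv0⟩ := (Submodule.ne_bot_iff _).1
    (LinearMap.ker_ne_bot_of_finrank_lt (f := (fderiv ℝ (ν ∘ φ) x).toLinearMap) (by simp [hG]))
  have hv : fderiv ℝ (ν ∘ φ) x v = 0 := hv
  ext u
  have h1 := fderiv_fderiv_symm (h.contDiffAt_normal_comp hx) u v
  rw [h.sndFDeriv_normal_comp_curvature hx, h.sndFDeriv_normal_comp_curvature hx,
    fderiv_fderiv_symm (h.contDiffAt_comp hx) u v, hv, zero_smul, add_zero, neg_inj,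
    add_eq_left, smul_eq_zero, h.fderiv_comp hx] at h1
  refine h1.resolve_right fun h2 => hv0 ?_
  have h3 := (h.hypersurface.pair _ (h.mem x hx)).injective (h2.trans (map_zero _).symm)
  exact h.injective x hx (h3.trans (map_zero _).symm)

theorem inner_normal_fderiv_comp (h : IsLocalIntegralSurface O f N ν D φ) {x : G} (hx : x ∈ D)
    (v : G) : ⟪fderiv ℝ (f ∘ φ) x v, N (φ x)⟫_ℝ = 0 := by
  rw [real_inner_comm, h.fderiv_comp hx]
  exact (h.hypersurface.pair _ (h.mem x hx)).inner_normal _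

theorem inner_sndFDeriv_comp_normal (h : IsLocalIntegralSurface O f N ν D φ) {x : G} (hx : x ∈ D)
    (u v : G) : ⟪fderiv ℝ (fderiv ℝ (f ∘ φ)) x u v, N (φ x)⟫_ℝ =
      ν (φ x) * ⟪fderiv ℝ (f ∘ φ) x u, fderiv ℝ (f ∘ φ) x v⟫_ℝ := by
  have d1 := (contDiffAt_fderiv (h.contDiffAt_comp hx)).differentiableAt (by simp)
  have d2 := (h.contDiffAt_normal_comp hx).differentiableAt (by simp)
  have key : (fun y => ⟪fderiv ℝ (f ∘ φ) y v, (N ∘ φ) y⟫_ℝ) =ᶠ[𝓝 x] fun _ => 0 := by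
    filter_upwards [h.isOpen.mem_nhds hx] with y hy using h.inner_normal_fderiv_comp hy v
  have := congrArg (fun T : G →L[ℝ] ℝ => T u) key.fderiv_eq
  rw [fderiv_inner_apply ℝ (d1.clm_apply (differentiableAt_const v)) d2, fderiv_apply_const d1,
    h.fderiv_normal_comp_eq hx, inner_neg_right, real_inner_smul_right] at this
  simp only [fderiv_fun_const, Pi.zero_apply, zero_apply] at this
  rw [real_inner_comm (fderiv ℝ (f ∘ φ) x v) (fderiv ℝ (f ∘ φ) x u)]
  have h' : (N ∘ φ) x = N (φ x) := rfl
  rw [h'] at this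
  linarith

theorem sndFDeriv_normal_comp_chain (h : IsLocalIntegralSurface O f N ν D φ) {x : G} (hx : x ∈ D)
    (u v : G) : fderiv ℝ (fderiv ℝ (N ∘ φ)) x u v =
      fderiv ℝ (fderiv ℝ N) (φ x) (fderiv ℝ φ x u) (fderiv ℝ φ x v)
        + fderiv ℝ N (φ x) (fderiv ℝ (fderiv ℝ φ) x u v) := by
  have d1 := (contDiffAt_fderiv (h.contDiffAt x hx)).differentiableAt (by simp)
  have d2 := (contDiffAt_fderiv (h.contDiffAt_normal_comp hx)).differentiableAt (by simp)
  have d3 := h.hypersurface.differentiableAt_fderiv_normal (h.mem x hx)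
  have d4 := (h.contDiffAt x hx).differentiableAt (by simp)
  have key : (fun y => fderiv ℝ (N ∘ φ) y v)
      =ᶠ[𝓝 x] fun y => (fderiv ℝ N ∘ φ) y (fderiv ℝ φ y v) := by
    filter_upwards [h.isOpen.mem_nhds hx] with y hy using h.fderiv_normal_comp hy v
  have := congrArg (fun T : G →L[ℝ] F => T u) key.fderiv_eq
  rw [fderiv_apply_const d2, fderiv_clm_apply (d3.comp x d4)
    (d1.clm_apply (differentiableAt_const v)), _root_.fderiv_comp x d3 d4] at this
  rw [this]
  simp [fderiv_apply_const d1, add_comm]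

/-- The integral surface has no flat points and is totally umbilical in the ambient space, also in
the normal directions tangent to the hypersurface. -/
theorem isLocalUmbilical (h : IsLocalIntegralSurface O f N ν D φ) :
    IsLocalUmbilical D (f ∘ φ) where
  isOpen := h.isOpen
  contDiffAt x hx := h.contDiffAt_comp hx
  injective x hx v w hvw := by
    rw [h.fderiv_comp hx, h.fderiv_comp hx] at hvw
    exact h.injective x hx ((h.hypersurface.pair _ (h.mem x hx)).injective hvw)
  umbilical x hx η hη := by
    have hp := h.hypersurface.pair _ (h.mem x hx)
    -- decompose `η` into its component along `N` and a tangent vector of the hypersurface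
    obtain ⟨z, hz⟩ := hp.exists_of_inner_normal (η - ⟪N (φ x), η⟫_ℝ • N (φ x)) (by
      rw [inner_sub_right, real_inner_smul_right, real_inner_self_eq_norm_sq, hp.norm_normal]
      ring)
    have hz0 : fderiv ℝ N (φ x) z = 0 := by
      refine hp.eq_zero_of_orthogonal fun v hv => ?_
      obtain ⟨t, rfl⟩ := (h.mem_range_iff x hx v).2 hv
      rw [← h.fderiv_comp hx, hz, real_inner_comm, inner_sub_right, real_inner_smul_right, hη,
        h.inner_normal_fderiv_comp hx]
      ring
    refine ⟨⟪N (φ x), η⟫_ℝ * ν (φ x) + fderiv ℝ ν (φ x) z / ν (φ x), fun u v => ?_⟩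
    have e1 := h.inner_sndFDeriv_comp_normal hx u v
    have e2 := h.hypersurface.inner_sndFDeriv_normal (h.mem x hx)
      ((h.mem_range_iff x hx _).1 ⟨u, rfl⟩) ((h.mem_range_iff x hx _).1 ⟨v, rfl⟩) hz0
    have e3 := congrArg (fun y => ⟪y, fderiv ℝ f (φ x) z⟫_ℝ)
      ((h.sndFDeriv_normal_comp_curvature hx u v).symm.trans (h.sndFDeriv_normal_comp_chain hx u v))
    have e4 : ⟪fderiv ℝ (f ∘ φ) x v, fderiv ℝ f (φ x) z⟫_ℝ = 0 := by
      rw [hz, inner_sub_right, real_inner_smul_right, hη, h.inner_normal_fderiv_comp hx]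
      ring
    simp only [inner_neg_left, inner_add_left, real_inner_smul_left, e4, e2, hp.inner_symm _ z,
      hz0, inner_zero_right, ← h.fderiv_comp hx] at e3
    have e5 : η = ⟪N (φ x), η⟫_ℝ • N (φ x) + fderiv ℝ f (φ x) z := by rw [hz]; abel
    have e6 : ⟪fderiv ℝ (fderiv ℝ (f ∘ φ)) x u v, fderiv ℝ f (φ x) z⟫_ℝ
        = fderiv ℝ ν (φ x) z / ν (φ x) * ⟪fderiv ℝ (f ∘ φ) x u, fderiv ℝ (f ∘ φ) x v⟫_ℝ := by
      rw [div_mul_eq_mul_div, eq_div_iff hp.ne_zero]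
      linarith
    conv_lhs => rw [e5]
    rw [inner_add_right, real_inner_smul_right, e1, e6]
    ring
  nonflat x hx := ⟨N (φ x), h.inner_normal_fderiv_comp hx, ν (φ x),
    (h.hypersurface.pair _ (h.mem x hx)).ne_zero, h.inner_sndFDeriv_comp_normal hx⟩

/-- The curvature and the centre of the osculating hypersphere are constant along an integral
surface. -/
theorem eventually_const (h : IsLocalIntegralSurface O f N ν D φ) (hG : Module.finrank ℝ G = 2)
    {x₀ : G} (hx₀ : x₀ ∈ D) :
    ∀ᶠ x in 𝓝 x₀, ν (φ x) = ν (φ x₀) ∧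
      N (φ x) + ν (φ x) • f (φ x) = N (φ x₀) + ν (φ x₀) • f (φ x₀) := by
  have hD := h.isOpen.mem_nhds hx₀
  have h1 : ∀ᶠ x in 𝓝 x₀, (ν ∘ φ) x = (ν ∘ φ) x₀ := eventually_eq_of_fderiv_eq_zero
    (by filter_upwards [hD] with x hx using h.differentiableAt_curvature_comp hx)
    (by filter_upwards [hD] with x hx using h.fderiv_curvature_comp hG hx)
  have hd : ∀ x ∈ D, HasFDerivAt (fun x => (N ∘ φ) x + (ν ∘ φ) x₀ • (f ∘ φ) x)
      (fderiv ℝ (N ∘ φ) x + (ν ∘ φ) x₀ • fderiv ℝ (f ∘ φ) x) x := fun x hx =>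
    ((h.contDiffAt_normal_comp hx).differentiableAt (by simp)).hasFDerivAt.add
      (((h.contDiffAt_comp hx).differentiableAt (by simp)).hasFDerivAt.const_smul _)
  have h2 := eventually_eq_of_fderiv_eq_zero (x := x₀)
    (by filter_upwards [hD] with x hx using (hd x hx).differentiableAt)
    (by
      filter_upwards [hD, h1] with x hx hκ
      rw [(hd x hx).fderiv]
      ext v
      rw [add_apply, smul_apply, h.fderiv_normal_comp_eq hx, ← hκ]
      simp)
  filter_upwards [h1, h2] with x hx hx'
  exact ⟨hx, by rw [show ν (φ x) = ν (φ x₀) from hx]; exact hx'⟩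

end IsLocalIntegralSurface

end LocalIntegralSurface

/-! ### The shape operator in terms of the differentials -/

section ShapeOperator

variable {T F : Type*} [AddCommGroup T] [Module ℝ T] [NormedAddCommGroup F] [InnerProductSpace ℝ F]

/-- The image of an immersion is the orthogonal complement of the normal, by dimension count. -/
theorem exists_of_inner_eq_zero {n : ℕ} (hF : Module.finrank ℝ F = n + 1)
    (hT : Module.finrank ℝ T = n) {a : T →ₗ[ℝ] F} {m : F} (ha : Function.Injective a)
    (hm : ‖m‖ = 1) (hma : ∀ v, ⟪m, a v⟫_ℝ = 0) {η : F} (hη : ⟪m, η⟫_ℝ = 0) : ∃ z, a z = η := by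
  have : Fact (Module.finrank ℝ F = n + 1) := ⟨hF⟩
  have : FiniteDimensional ℝ F := .of_finrank_pos (by omega)
  have hm0 : m ≠ 0 := by
    rintro rfl
    simp at hm
  have hle : a.range ≤ (ℝ ∙ m)ᗮ := by
    rintro _ ⟨v, rfl⟩
    rw [Submodule.mem_orthogonal_singleton_iff_inner_right]
    exact hma v
  have heq := Submodule.eq_of_le_of_finrank_eq hle
    (by rw [LinearMap.finrank_range_of_inj ha, hT,
      Submodule.finrank_orthogonal_span_singleton (n := n) hm0])
  have : η ∈ a.range := by
    rw [heq, Submodule.mem_orthogonal_singleton_iff_inner_right]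
    exact hη
  exact this

theorem map_shape {a b : T →ₗ[ℝ] F} (ha : Function.Injective a) (hb : ∀ v, ∃ z, a z = b v) (v : T) :
    a ((-(a.leftInverse ∘ₗ b) : Module.End ℝ T) v) = -b v := by
  obtain ⟨z, hz⟩ := hb v
  rw [LinearMap.neg_apply, LinearMap.comp_apply, ← hz,
    LinearMap.leftInverse_apply_of_inj (LinearMap.ker_eq_bot.2 ha), map_neg]

/-- Translation of the condition on the shape operator into the equation `b = -a ∘ A`. -/
theorem isBiUmbilicalPair_of_shape {n : ℕ} (hF : Module.finrank ℝ F = n + 1)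
    (hT : Module.finrank ℝ T = n) {a b : T →ₗ[ℝ] F} {m : F} (ha : Function.Injective a)
    (hm : ‖m‖ = 1) (hma : ∀ v, ⟪m, a v⟫_ℝ = 0) (hmb : ∀ v, ⟪m, b v⟫_ℝ = 0)
    {A : Module.End ℝ T} (hA : A = -(a.leftInverse ∘ₗ b)) {ν : ℝ} (hν : ν ≠ 0) {X Y : T}
    (hX : ⟪a X, a X⟫_ℝ = 1) (hY : ⟪a Y, a Y⟫_ℝ = 1) (hXY : ⟪a X, a Y⟫_ℝ = 0)
    (hAX : A X = ν • X) (hAY : A Y = ν • Y)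
    (hA0 : ∀ x, ⟪a x, a X⟫_ℝ = 0 → ⟪a x, a Y⟫_ℝ = 0 → A x = 0) :
    IsBiUmbilicalPair a b m ν ∧
      ∀ v, v ∈ Submodule.span ℝ {v | ∃ ν : ℝ, ν ≠ 0 ∧ A v = ν • v} ↔ b v = -(ν • a v) := by
  have hex : ∀ η, ⟪m, η⟫_ℝ = 0 → ∃ z, a z = η := fun η hη =>
    exists_of_inner_eq_zero hF hT ha hm hma hη
  have haA : ∀ v, a (A v) = -b v := fun v => by
    rw [hA]
    exact map_shape ha (fun v => hex _ (hmb v)) v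
  have hYX : ⟪a Y, a X⟫_ℝ = 0 := by rw [real_inner_comm, hXY]
  have hAu : ∀ u, A u = ν • (⟪a u, a X⟫_ℝ • X + ⟪a u, a Y⟫_ℝ • Y) := fun u => by
    have h1 := hA0 (u - ⟪a u, a X⟫_ℝ • X - ⟪a u, a Y⟫_ℝ • Y)
      (by simp only [map_sub, map_smul, inner_sub_left, real_inner_smul_left, hX, hYX]; ring)
      (by simp only [map_sub, map_smul, inner_sub_left, real_inner_smul_left, hY, hXY]; ring)
    rw [map_sub, map_sub, map_smul, map_smul, hAX, hAY, sub_sub, sub_eq_zero] at h1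
    rw [h1, smul_add, smul_comm ν, smul_comm ν]
  have hb : ∀ u, b u = -(ν • (⟪a u, a X⟫_ℝ • a X + ⟪a u, a Y⟫_ℝ • a Y)) := fun u => by
    rw [← neg_neg (b u), ← haA, hAu, map_smul, map_add, map_smul, map_smul]
  refine ⟨⟨hν, ha, hm, hma, hex, X, Y, hX, hY, hXY, hb⟩, fun v => ⟨fun hv => ?_, fun hv => ?_⟩⟩
  · have hle : Submodule.span ℝ {v | ∃ ν : ℝ, ν ≠ 0 ∧ A v = ν • v}
        ≤ (b + ν • a).ker := by
      rw [Submodule.span_le]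
      rintro w ⟨μ, hμ, hw⟩
      have hwe : w = (μ⁻¹ * ν) • (⟪a w, a X⟫_ℝ • X + ⟪a w, a Y⟫_ℝ • Y) := by
        rw [mul_smul, ← hAu, hw, inv_smul_smul₀ hμ]
      have hAw : A w = ν • w := by
        rw [hwe, map_smul, map_add, map_smul, map_smul, hAX, hAY]
        module
      have := haA w
      rw [hAw, map_smul] at this
      simp [this]
    have := hle hv
    rw [LinearMap.mem_ker, LinearMap.add_apply, LinearMap.smul_apply] at this
    exact eq_neg_of_add_eq_zero_left this
  · refine Submodule.subset_span ⟨ν, hν, ha ?_⟩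
    rw [haA, hv, neg_neg, map_smul]

end ShapeOperator

/-! ### Manifold derivatives in charts -/

section Charts

variable {E H M F : Type*} [NormedAddCommGroup E] [NormedSpace ℝ E] [TopologicalSpace H]
  {I : ModelWithCorners ℝ E H} [TopologicalSpace M] [ChartedSpace H M]
  [NormedAddCommGroup F] [NormedSpace ℝ F]

/-- A manifold derivative in terms of the derivative of the function in a fixed chart. -/
theorem mvfderiv_eq_fderiv_chart [IsManifold I 1 M] {f : M → F} {p₀ p : M}
    (hp : p ∈ (extChartAt I p₀).source)
    (hf : DifferentiableAt ℝ (f ∘ (extChartAt I p₀).symm) (extChartAt I p₀ p))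
    (v : TangentSpace I p) :
    mvfderiv I f p v = fderiv ℝ (f ∘ (extChartAt I p₀).symm) (extChartAt I p₀ p)
      (mvfderiv I (extChartAt I p₀) p v) := by
  have hψ : HasMFDerivAt I 𝓘(ℝ, E) (extChartAt I p₀) p (mfderiv I 𝓘(ℝ, E) (extChartAt I p₀) p) :=
    (mdifferentiableAt_extChartAt (by rwa [← extChartAt_source I])).hasMFDerivAt
  have h1 := (hf.hasFDerivAt.hasMFDerivAt.comp p hψ).congr_of_eventuallyEq (f₁ := f) (by
    filter_upwards [(isOpen_extChartAt_source (I := I) p₀).mem_nhds hp] with q hq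
    simp only [Function.comp_apply]
    rw [(extChartAt I p₀).left_inv hq])
  have h2 := h1.mfderiv
  exact congrArg (fun L => L v) h2

theorem bijective_mvfderiv_extChartAt [IsManifold I 1 M] {p₀ p : M}
    (hp : p ∈ (extChartAt I p₀).source) :
    Function.Bijective (mvfderiv I (extChartAt I p₀) p) := by
  obtain ⟨e, he⟩ := isInvertible_mfderiv_extChartAt (I := I) hp
  have h : (mvfderiv I (extChartAt I p₀) p : TangentSpace I p → E) = e := by
    ext v
    exact (congrArg (fun L => L v) he).symm
  rw [h]
  exact e.bijective

variable [I.Boundaryless]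

theorem contDiffAt_comp_extChartAt_symm [IsManifold I ∞ M] {f : M → F} {p₀ p : M}
    (hp : p ∈ (extChartAt I p₀).source) (hf : ContMDiffAt I 𝓘(ℝ, F) ∞ f p) :
    ContDiffAt ℝ ∞ (f ∘ (extChartAt I p₀).symm) (extChartAt I p₀ p) := by
  have h1 : ContMDiffAt 𝓘(ℝ, E) I ∞ (extChartAt I p₀).symm (extChartAt I p₀ p) :=
    (contMDiffOn_extChartAt_symm p₀).contMDiffAt
      ((isOpen_extChartAt_target p₀).mem_nhds ((extChartAt I p₀).map_source hp))
  exact (ContMDiffAt.comp_of_eq hf h1 ((extChartAt I p₀).left_inv hp)).contDiffAt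

theorem eventually_nhds_extChartAt_iff {p₀ p : M} (hp : p ∈ (extChartAt I p₀).source)
    {P : M → Prop} :
    (∀ᶠ x in 𝓝 (extChartAt I p₀ p), P ((extChartAt I p₀).symm x)) ↔ ∀ᶠ q in 𝓝 p, P q := by
  have h := (chartAt H p₀).map_extend_nhds_of_boundaryless (I := I)
    (by rwa [← extChartAt_source I])
  change map (extChartAt I p₀) (𝓝 p) = 𝓝 (extChartAt I p₀ p) at h
  rw [← h, eventually_map]
  refine eventually_congr ?_
  filter_upwards [(isOpen_extChartAt_source (I := I) p₀).mem_nhds hp] with q hq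
  rw [(extChartAt I p₀).left_inv hq]

theorem isOpen_target_inter_preimage {p₀ : M} {U : Set M} (hU : IsOpen U) :
    IsOpen ((extChartAt I p₀).target ∩ (extChartAt I p₀).symm ⁻¹' U) :=
  (continuousOn_extChartAt_symm p₀).isOpen_inter_preimage (isOpen_extChartAt_target p₀) hU

end Charts

/-! ### Integral surfaces lie on round spheres -/

section Manifold

variable {n : ℕ} {E₀ : Type*} [NormedAddCommGroup E₀] [NormedSpace ℝ E₀]
  {H : Type*} [TopologicalSpace H] {I : ModelWithCorners ℝ E₀ H}
  {M : Type*} [TopologicalSpace M] [ChartedSpace H M] {U : Set M} {f N : M → Ambient n}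

theorem IsHypersurface.inner_mvfderiv_normal (h : IsHypersurface I U f N) {p : M} (hp : p ∈ U)
    (v : TangentSpace I p) : ⟪N p, mvfderiv I N p v⟫_ℝ = 0 := by
  have hU := h.isOpen.mem_nhds hp
  have hN : HasMFDerivAt I 𝓘(ℝ, Ambient n) N p (mfderiv I 𝓘(ℝ, Ambient n) N p) :=
    ((h.normal_contMDiffOn.contMDiffAt hU).mdifferentiableAt (by simp)).hasMFDerivAt
  have hs : HasFDerivAt (fun y : Ambient n => ‖y‖ ^ 2) (2 • innerSL ℝ (N p)) (N p) :=
    (hasStrictFDerivAt_norm_sq (N p)).hasFDerivAt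
  have h1 := (hs.hasMFDerivAt.comp p hN).congr_of_eventuallyEq (f₁ := fun _ => (1 : ℝ)) (by
    filter_upwards [hU] with q hq
    simp [h.normal_norm q hq])
  have h2 := hasMFDerivAt_unique h1 (hasMFDerivAt_const (1 : ℝ) p)
  have h3 : (2 : ℕ) • ⟪N p, mvfderiv I N p v⟫_ℝ = 0 := congrArg (fun L => L v) h2
  simpa using h3

theorem IsHypersurface.isBiUmbilicalPair (h : IsHypersurface I U f N) {p : M} (hp : p ∈ U)
    {ν : ℝ} (hν : IsTypeNumberTwoAt I f N p ν ν) :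
    IsBiUmbilicalPair (mvfderiv I f p) (mvfderiv I N p) (N p) ν ∧
      ∀ v, v ∈ distributionΔ I f N p ↔ mvfderiv I N p v = -(ν • mvfderiv I f p v) := by
  obtain ⟨hν0, -, X, Y, hX, hY, hXY, hAX, hAY, hA⟩ := hν
  exact isBiUmbilicalPair_of_shape (n := n) (T := TangentSpace I p)
    (a := (mvfderiv I f p).toLinearMap) (b := (mvfderiv I N p).toLinearMap)
    (by simp) h.finrank_eq (h.injective_deriv p hp) (h.normal_norm p hp)
    (h.normal_orthogonal p hp) (h.inner_mvfderiv_normal hp) rfl hν0 hX hY hXY hAX hAY hA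

theorem IsBiUmbilical.exists_curvature (h : IsBiUmbilical I U f N) :
    ∃ ν : M → ℝ, ∀ p ∈ U, IsBiUmbilicalPair (mvfderiv I f p) (mvfderiv I N p) (N p) (ν p) ∧
      ∀ v, v ∈ distributionΔ I f N p ↔ mvfderiv I N p v = -(ν p • mvfderiv I f p v) := by
  choose! ν hν using h.biumbilical
  exact ⟨ν, fun p hp => h.toIsHypersurface.isBiUmbilicalPair hp (hν p hp)⟩

variable {S : Type*} [TopologicalSpace S] [ChartedSpace (EuclideanSpace ℝ (Fin 2)) S] {φ : S → M}

/-- The part of the chart domain at `s₀` which is mapped by `φ` into the chart domain at `φ s₀`,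
in coordinates. -/
def chartDomain (I : ModelWithCorners ℝ E₀ H) (φ : S → M) (s₀ : S) :
    Set (EuclideanSpace ℝ (Fin 2)) :=
  (extChartAt (𝓡 2) s₀).target ∩
    (extChartAt (𝓡 2) s₀).symm ⁻¹' (φ ⁻¹' (extChartAt I (φ s₀)).source)

theorem exists_of_mem_chartDomain {s₀ : S} {x : EuclideanSpace ℝ (Fin 2)}
    (hx : x ∈ chartDomain I φ s₀) : ∃ s ∈ (extChartAt (𝓡 2) s₀).source,
      φ s ∈ (extChartAt I (φ s₀)).source ∧ extChartAt (𝓡 2) s₀ s = x :=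
  ⟨_, (extChartAt (𝓡 2) s₀).map_target hx.1, hx.2, (extChartAt (𝓡 2) s₀).right_inv hx.1⟩

theorem mem_chartDomain_self (s₀ : S) : extChartAt (𝓡 2) s₀ s₀ ∈ chartDomain I φ s₀ :=
  ⟨mem_extChartAt_target s₀, by simp⟩

variable [I.Boundaryless] [IsManifold I ∞ M] [IsManifold (𝓡 2) ∞ S]

theorem IsHypersurface.isLocalBiUmbilical (h : IsHypersurface I U f N) {ν : M → ℝ}
    (hν : ∀ p ∈ U, IsBiUmbilicalPair (mvfderiv I f p) (mvfderiv I N p) (N p) (ν p)) (p₀ : M) :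
    IsLocalBiUmbilical ((extChartAt I p₀).target ∩ (extChartAt I p₀).symm ⁻¹' U)
      (f ∘ (extChartAt I p₀).symm) (N ∘ (extChartAt I p₀).symm) (ν ∘ (extChartAt I p₀).symm) := by
  have : IsManifold I 1 M := .of_le (n := ∞) (by simp)
  set ψ := extChartAt I p₀
  have key : ∀ y ∈ ψ.target ∩ ψ.symm ⁻¹' U, ∃ p ∈ ψ.source, p ∈ U ∧ ψ p = y := fun y hy =>
    ⟨ψ.symm y, ψ.map_target hy.1, hy.2, ψ.right_inv hy.1⟩
  have hf : ∀ p ∈ ψ.source, p ∈ U → ContDiffAt ℝ ∞ (f ∘ ψ.symm) (ψ p) := fun p hp hpU =>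
    contDiffAt_comp_extChartAt_symm hp (h.contMDiffOn.contMDiffAt (h.isOpen.mem_nhds hpU))
  have hN : ∀ p ∈ ψ.source, p ∈ U → ContDiffAt ℝ ∞ (N ∘ ψ.symm) (ψ p) := fun p hp hpU =>
    contDiffAt_comp_extChartAt_symm hp (h.normal_contMDiffOn.contMDiffAt (h.isOpen.mem_nhds hpU))
  refine ⟨isOpen_target_inter_preimage h.isOpen, ?_, ?_, ?_⟩
  · intro y hy
    obtain ⟨p, hp, hpU, rfl⟩ := key y hy
    exact hf p hp hpU
  · intro y hy
    obtain ⟨p, hp, hpU, rfl⟩ := key y hy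
    exact hN p hp hpU
  · intro y hy
    obtain ⟨p, hp, hpU, rfl⟩ := key y hy
    simp only [Function.comp_apply]
    rw [ψ.left_inv hp]
    refine IsBiUmbilicalPair.of_comp_bijective (bijective_mvfderiv_extChartAt hp) ?_
    convert! hν p hpU using 1
    · ext v : 1
      exact (mvfderiv_eq_fderiv_chart hp ((hf p hp hpU).differentiableAt (by simp)) v).symm
    · ext v : 1
      exact (mvfderiv_eq_fderiv_chart hp ((hN p hp hpU).differentiableAt (by simp)) v).symm

theorem IsIntegralSurface.isLocalIntegralSurface (hφ : IsIntegralSurface I U f N φ)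
    (h : IsHypersurface I U f N) {ν : M → ℝ}
    (hν : ∀ p ∈ U, IsBiUmbilicalPair (mvfderiv I f p) (mvfderiv I N p) (N p) (ν p) ∧
      ∀ v, v ∈ distributionΔ I f N p ↔ mvfderiv I N p v = -(ν p • mvfderiv I f p v)) (s₀ : S) :
    IsLocalIntegralSurface
      ((extChartAt I (φ s₀)).target ∩ (extChartAt I (φ s₀)).symm ⁻¹' U)
      (f ∘ (extChartAt I (φ s₀)).symm) (N ∘ (extChartAt I (φ s₀)).symm)
      (ν ∘ (extChartAt I (φ s₀)).symm) (chartDomain I φ s₀)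
      (extChartAt I (φ s₀) ∘ φ ∘ (extChartAt (𝓡 2) s₀).symm) := by
  have : IsManifold I 1 M := .of_le (n := ∞) (by simp)
  have : IsManifold (𝓡 2) 1 S := .of_le (n := ∞) (by simp)
  have hloc := h.isLocalBiUmbilical (fun p hp => (hν p hp).1) (φ s₀)
  set ψ := extChartAt I (φ s₀)
  set χ := extChartAt (𝓡 2) s₀
  have hmem : ∀ s, φ s ∈ ψ.source → ψ (φ s) ∈ ψ.target ∩ ψ.symm ⁻¹' U := fun s hs =>
    ⟨ψ.map_source hs, by rw [Set.mem_preimage, ψ.left_inv hs]; exact hφ.mem s⟩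
  have hval : ∀ s ∈ χ.source, (ψ ∘ φ ∘ χ.symm) (χ s) = ψ (φ s) := fun s hs => by
    simp [χ.left_inv hs]
  have hcd : ∀ s ∈ χ.source, φ s ∈ ψ.source → ContDiffAt ℝ ∞ (ψ ∘ φ ∘ χ.symm) (χ s) := by
    intro s hs hs'
    exact contDiffAt_comp_extChartAt_symm (f := ψ ∘ φ) hs
      ((contMDiffAt_extChartAt' (by rwa [← extChartAt_source I])).comp s (hφ.contMDiff s))
  -- the chain rule, in both charts
  have hder : ∀ s ∈ χ.source, φ s ∈ ψ.source → ∀ v : TangentSpace (𝓡 2) s,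
      fderiv ℝ (ψ ∘ φ ∘ χ.symm) (χ s) (mvfderiv (𝓡 2) χ s v)
        = mvfderiv I ψ (φ s) (mfderiv (𝓡 2) I φ s v) := by
    intro s hs hs' v
    have h1 := mvfderiv_eq_fderiv_chart (f := ψ ∘ φ) hs
      ((hcd s hs hs').differentiableAt (by simp)) v
    refine h1.symm.trans ?_
    have h2 := mfderiv_comp s (I := 𝓡 2) (I' := I) (I'' := 𝓘(ℝ, E₀))
      (mdifferentiableAt_extChartAt (I := I) (x := φ s₀) (y := φ s)
        (by rwa [← extChartAt_source I])) ((hφ.contMDiff s).mdifferentiableAt (by simp))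
    exact congrArg (fun L => L v) h2
  refine ⟨hloc, ?_, ?_, ?_, ?_, ?_⟩
  · exact isOpen_target_inter_preimage
      ((isOpen_extChartAt_source _).preimage hφ.contMDiff.continuous)
  · intro x hx
    obtain ⟨s, hs, hs', rfl⟩ := exists_of_mem_chartDomain hx
    rw [hval s hs]
    exact hmem s hs'
  · intro x hx
    obtain ⟨s, hs, hs', rfl⟩ := exists_of_mem_chartDomain hx
    exact hcd s hs hs'
  · intro x hx
    obtain ⟨s, hs, hs', rfl⟩ := exists_of_mem_chartDomain hx
    intro v w hvw
    obtain ⟨v, rfl⟩ := (bijective_mvfderiv_extChartAt hs).2 v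
    obtain ⟨w, rfl⟩ := (bijective_mvfderiv_extChartAt hs).2 w
    have h1 := (hder s hs hs' v).symm.trans (hvw.trans (hder s hs hs' w))
    rw [hφ.injective_deriv s ((bijective_mvfderiv_extChartAt hs').1 h1)]
  · intro x hx w
    obtain ⟨s, hs, hs', rfl⟩ := exists_of_mem_chartDomain hx
    obtain ⟨t, rfl⟩ := (bijective_mvfderiv_extChartAt hs').2 w
    have hiff : mvfderiv I ψ (φ s) t ∈ Set.range (fderiv ℝ (ψ ∘ φ ∘ χ.symm) (χ s)) ↔
        t ∈ (mfderiv (𝓡 2) I φ s).toLinearMap.range := by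
      constructor
      · rintro ⟨k, hk⟩
        obtain ⟨v, rfl⟩ := (bijective_mvfderiv_extChartAt hs).2 k
        exact ⟨v, (bijective_mvfderiv_extChartAt hs').1 ((hder s hs hs' v).symm.trans hk)⟩
      · rintro ⟨v, rfl⟩
        exact ⟨_, hder s hs hs' v⟩
    have e1 := mvfderiv_eq_fderiv_chart (f := f) hs'
      ((hloc.contDiffAt _ (hmem s hs')).differentiableAt (by simp)) t
    have e2 := mvfderiv_eq_fderiv_chart (f := N) hs'
      ((hloc.normal_contDiffAt _ (hmem s hs')).differentiableAt (by simp)) t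
    rw [hiff, hφ.range_deriv s, (hν _ (hφ.mem s)).2, e1, e2, hval s hs, Function.comp_apply,
      ψ.left_inv hs']

/-- Near each point, an integral surface lies in a three-dimensional affine space. -/
theorem IsIntegralSurface.exists_osculatingSpace (hφ : IsIntegralSurface I U f N φ)
    (h : IsBiUmbilical I U f N) (s₀ : S) :
    ∃ V : Submodule ℝ (Ambient n), Module.finrank ℝ V = 3 ∧ ∀ᶠ s in 𝓝 s₀, ∀ b, b ∈ Vᗮ ↔
      ∀ᶠ t in 𝓝 s, ⟪f (φ t), b⟫_ℝ = ⟪f (φ s), b⟫_ℝ := by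
  obtain ⟨ν, hν⟩ := h.exists_curvature
  have hloc := hφ.isLocalIntegralSurface h.toIsHypersurface hν s₀
  obtain ⟨V, hV, hev⟩ := hloc.isLocalUmbilical.exists_osculatingSpace (by simp)
    (mem_chartDomain_self s₀)
  refine ⟨V, hV, ?_⟩
  set ψ := extChartAt I (φ s₀) with hψ
  set χ := extChartAt (𝓡 2) s₀ with hχ
  have hD : ∀ᶠ x in 𝓝 (χ s₀), x ∈ chartDomain I φ s₀ :=
    hloc.isOpen.mem_nhds (mem_chartDomain_self s₀)
  have hval : ∀ x ∈ chartDomain I φ s₀,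
      ((f ∘ ψ.symm) ∘ ψ ∘ φ ∘ χ.symm) x = f (φ (χ.symm x)) := fun x hx => by
    simp only [Function.comp_apply]
    rw [ψ.left_inv hx.2]
  rw [← eventually_nhds_extChartAt_iff (I := 𝓡 2) (mem_extChartAt_source s₀)]
  filter_upwards [hev, hD.eventually_nhds] with x hx hxD b
  rw [hx b]
  obtain ⟨s, hs, hs', rfl⟩ := exists_of_mem_chartDomain hxD.self_of_nhds
  rw [χ.left_inv hs, ← eventually_nhds_extChartAt_iff hs, hval _ hxD.self_of_nhds,
    χ.left_inv hs]
  refine eventually_congr ?_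
  filter_upwards [hxD] with y hy
  rw [hval y hy]

theorem IsIntegralSurface.eventually_const (hφ : IsIntegralSurface I U f N φ)
    (h : IsHypersurface I U f N) {ν : M → ℝ}
    (hν : ∀ p ∈ U, IsBiUmbilicalPair (mvfderiv I f p) (mvfderiv I N p) (N p) (ν p) ∧
      ∀ v, v ∈ distributionΔ I f N p ↔ mvfderiv I N p v = -(ν p • mvfderiv I f p v)) (s₀ : S) :
    ∀ᶠ s in 𝓝 s₀, ν (φ s) = ν (φ s₀) ∧
      N (φ s) + ν (φ s) • f (φ s) = N (φ s₀) + ν (φ s₀) • f (φ s₀) := by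
  have hloc := hφ.isLocalIntegralSurface h hν s₀
  have hev := hloc.eventually_const (by simp) (mem_chartDomain_self s₀)
  have hD := hloc.isOpen.mem_nhds (mem_chartDomain_self (I := I) (φ := φ) s₀)
  rw [← eventually_nhds_extChartAt_iff (I := 𝓡 2) (mem_extChartAt_source s₀)]
  have hself := mem_chartDomain_self (I := I) (φ := φ) s₀
  have hval : ∀ x ∈ chartDomain I φ s₀, (extChartAt I (φ s₀)).symm
      ((extChartAt I (φ s₀) ∘ φ ∘ (extChartAt (𝓡 2) s₀).symm) x)
      = φ ((extChartAt (𝓡 2) s₀).symm x) := fun x hx => (extChartAt I (φ s₀)).left_inv hx.2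
  filter_upwards [hev, hD] with x hx hxD
  simp only [Function.comp_apply (f := f), Function.comp_apply (f := N),
    Function.comp_apply (f := ν), hval x hxD, hval _ hself, extChartAt_to_inv] at hx
  exact hx

/-- An integral surface of the distribution of a bi-umbilical hypersurface lies on a round sphere
in a three-dimensional affine space. -/
theorem IsIntegralSurface.exists_roundSphere [ConnectedSpace S] (hφ : IsIntegralSurface I U f N φ)
    (h : IsBiUmbilical I U f N) :
    ∃ (V : Submodule ℝ (Ambient n)) (c : Ambient n) (r : ℝ),
      Module.finrank ℝ V = 3 ∧ 0 < r ∧ ∀ s, f (φ s) ∈ roundSphere V c r := by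
  obtain ⟨s₀⟩ := ‹ConnectedSpace S›.toNonempty
  obtain ⟨V, hV, hVs⟩ := hφ.exists_osculatingSpace h s₀
  -- the set of points near which `⟪f ∘ φ, b⟫` is constant is open and closed
  have hconst : ∀ b ∈ Vᗮ, ∀ s, ⟪f (φ s), b⟫_ℝ = ⟪f (φ s₀), b⟫_ℝ := by
    intro b hb
    have h1 : IsLocallyConstant
        (fun s => ∀ᶠ t in 𝓝 s, ⟪f (φ t), b⟫_ℝ = ⟪f (φ s), b⟫_ℝ) := by
      rw [IsLocallyConstant.iff_eventually_eq]
      intro s₁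
      obtain ⟨V₁, -, hV₁⟩ := hφ.exists_osculatingSpace h s₁
      filter_upwards [hV₁] with s hs
      exact propext ((hs b).symm.trans (hV₁.self_of_nhds b))
    have h2 : IsLocallyConstant (fun s => ⟪f (φ s), b⟫_ℝ) := by
      rw [IsLocallyConstant.iff_eventually_eq]
      intro s
      exact (h1.apply_eq_of_preconnectedSpace s₀ s).mp ((hVs.self_of_nhds b).1 hb)
    exact fun s => h2.apply_eq_of_preconnectedSpace s s₀
  have hmem : ∀ s, f (φ s) - f (φ s₀) ∈ V := by
    intro s
    rw [← Submodule.orthogonal_orthogonal V, Submodule.mem_orthogonal']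
    intro b hb
    rw [inner_sub_left, hconst b hb s, sub_self]
  -- the surface lies on a hypersphere of the ambient space
  obtain ⟨ν, hν⟩ := h.exists_curvature
  have hloc : IsLocallyConstant (fun s => (ν (φ s), N (φ s) + ν (φ s) • f (φ s))) := by
    rw [IsLocallyConstant.iff_eventually_eq]
    intro s
    filter_upwards [hφ.eventually_const h.toIsHypersurface hν s] with t ht
    rw [ht.1, ← ht.2, ht.1]
  set κ := ν (φ s₀) with hκ
  have hκ0 : κ ≠ 0 := (hν _ (hφ.mem s₀)).1.ne_zero
  set c₀ := κ⁻¹ • (N (φ s₀) + κ • f (φ s₀)) with hc₀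
  have hsphere : ∀ s, ‖f (φ s) - c₀‖ = |κ|⁻¹ := by
    intro s
    have h1 := hloc.apply_eq_of_preconnectedSpace s s₀
    simp only [Prod.mk.injEq] at h1
    rw [hc₀, hκ, ← h1.2, h1.1, ← hκ, smul_add, inv_smul_smul₀ hκ0, sub_add_cancel_right, norm_neg,
      norm_smul, (h.normal_norm _ (hφ.mem s)), mul_one, norm_inv, Real.norm_eq_abs]
  -- its centre is projected orthogonally to the three-dimensional affine space
  set c := f (φ s₀) + V.starProjection (c₀ - f (φ s₀)) with hc
  have hcV : ∀ s, f (φ s) - c ∈ V := fun s => by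
    rw [hc, ← sub_sub]
    exact V.sub_mem (hmem s) (Submodule.starProjection_apply_mem _ _)
  have hperp : c₀ - c ∈ Vᗮ := by
    rw [hc, ← sub_sub]
    exact Submodule.sub_starProjection_mem_orthogonal _
  have hpyth : ∀ s, ‖f (φ s) - c‖ * ‖f (φ s) - c‖ = |κ|⁻¹ * |κ|⁻¹ - ‖c₀ - c‖ * ‖c₀ - c‖ := by
    intro s
    have h1 : f (φ s) - c₀ = (f (φ s) - c) - (c₀ - c) := by abel
    have h2 := norm_sub_sq_eq_norm_sq_add_norm_sq_real
      (Submodule.inner_right_of_mem_orthogonal (hcV s) hperp)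
    rw [← h1, hsphere s] at h2
    linarith
  have hdist : ∀ s, ‖f (φ s) - c‖ = ‖f (φ s₀) - c‖ := fun s =>
    (mul_self_inj (norm_nonneg _) (norm_nonneg _)).1 ((hpyth s).trans (hpyth s₀).symm)
  refine ⟨V, c, ‖f (φ s₀) - c‖, hV, ?_, fun s => ⟨?_, ?_⟩⟩
  · rw [norm_pos_iff]
    intro h0
    -- a constant map would force the osculating space to be trivial
    have hall : ∀ s, f (φ s) = c := fun s => by
      have := hdist s
      rwa [h0, norm_zero, norm_sub_eq_zero_iff] at this
    have htop : Vᗮ = ⊤ := by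
      rw [eq_top_iff]
      intro b _
      exact (hVs.self_of_nhds b).2 (Eventually.of_forall fun t => by rw [hall, hall])
    rw [Submodule.orthogonal_eq_top_iff] at htop
    rw [htop, finrank_bot] at hV
    omega
  · rw [SetLike.mem_coe, AffineSubspace.mem_mk', vsub_eq_sub]
    exact hcV s
  · rw [mem_sphere_iff_norm, hdist s]

end Manifold

/-! ### The pointwise linear algebra of generated hypersurfaces -/

section GeneratedAlgebra

variable {T W F : Type*} [AddCommGroup T] [Module ℝ T] [AddCommGroup W] [Module ℝ W]
  [NormedAddCommGroup F] [InnerProductSpace ℝ F]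

/-- The differential of a generated hypersurface is injective: its restrictions to the tangent
plane of the sphere and to the generator are injective and have orthogonal images. -/
theorem injective_of_orthogonal_sum {j : T →ₗ[ℝ] F} {K : W →ₗ[ℝ] F} (hj : Function.Injective j)
    (hK : Function.Injective K) (hjK : ∀ s t, ⟪j s, K t⟫_ℝ = 0) {ρ : ℝ} (hρ : ρ ≠ 0)
    {a : T × W →ₗ[ℝ] F} (ha : ∀ s t, a (s, t) = ρ • j s + K t) : Function.Injective a := by
  rw [injective_iff_map_eq_zero]
  rintro ⟨s, t⟩ hst
  rw [ha] at hst
  have h1 := congrArg (fun y => ⟪j s, y⟫_ℝ) hst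
  simp only [inner_add_right, real_inner_smul_right, hjK, add_zero, inner_zero_right, mul_eq_zero,
    hρ, false_or, inner_self_eq_zero] at h1
  have hs : s = 0 := hj (h1.trans (map_zero j).symm)
  rw [h1, smul_zero, zero_add] at hst
  have ht : t = 0 := hK (hst.trans (map_zero K).symm)
  rw [hs, ht]
  rfl

theorem leftInverse_comp_apply {j : T →ₗ[ℝ] F} {K : W →ₗ[ℝ] F} {ρ k : ℝ} (hρ : ρ ≠ 0)
    {a b : T × W →ₗ[ℝ] F} (hinj : Function.Injective a) (ha : ∀ s t, a (s, t) = ρ • j s + K t)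
    (hb : ∀ s t, b (s, t) = k • j s) (s : T) (t : W) :
    (-(a.leftInverse ∘ₗ b) : Module.End ℝ (T × W)) (s, t) = (-(k / ρ)) • (s, 0) := by
  have h1 : b (s, t) = a ((k / ρ) • (s, 0)) := by
    rw [hb, map_smul, ha, map_zero, add_zero, smul_smul, div_mul_cancel₀ _ hρ]
  rw [LinearMap.neg_apply, LinearMap.comp_apply, h1,
    LinearMap.leftInverse_apply_of_inj (LinearMap.ker_eq_bot.2 hinj), neg_smul]

/-- The principal vectors of a generated hypersurface: an orthonormal basis of the tangent plane of
the sphere, rescaled. -/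
theorem exists_principal_vectors {j : T →ₗ[ℝ] F} {K : W →ₗ[ℝ] F}
    (hT : Module.finrank ℝ T = 2) (hj : Function.Injective j)
    (hjK : ∀ s t, ⟪j s, K t⟫_ℝ = 0) {ρ k : ℝ} (hρ : ρ ≠ 0)
    {a b : T × W →ₗ[ℝ] F} (hinj : Function.Injective a) (ha : ∀ s t, a (s, t) = ρ • j s + K t)
    (hb : ∀ s t, b (s, t) = k • j s)
    {A : Module.End ℝ (T × W)} (hA : A = -(a.leftInverse ∘ₗ b)) :
    ∃ X Y : T × W, ⟪a X, a X⟫_ℝ = 1 ∧ ⟪a Y, a Y⟫_ℝ = 1 ∧ ⟪a X, a Y⟫_ℝ = 0 ∧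
      A X = (-(k / ρ)) • X ∧ A Y = (-(k / ρ)) • Y ∧
      ∀ x, ⟪a x, a X⟫_ℝ = 0 → ⟪a x, a Y⟫_ℝ = 0 → A x = 0 := by
  have hAa : ∀ s t, A (s, t) = (-(k / ρ)) • (s, 0) := fun s t => by
    rw [hA]
    exact leftInverse_comp_apply hρ hinj ha hb s t
  have : FiniteDimensional ℝ T := .of_finrank_pos (by omega)
  have hR : Module.finrank ℝ j.range = 2 := by rw [LinearMap.finrank_range_of_inj hj, hT]
  set B := (stdOrthonormalBasis ℝ j.range).reindex (finCongr hR) with hB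
  have hex : ∀ i, ∃ s, a (s, 0) = (B i : F) := fun i => by
    obtain ⟨s, hs⟩ := (B i).2
    refine ⟨ρ⁻¹ • s, ?_⟩
    rw [ha, map_smul, hs, smul_inv_smul₀ hρ, map_zero, add_zero]
  choose s hs using hex
  have hBB : ∀ i i', ⟪(B i : F), (B i' : F)⟫_ℝ = if i = i' then 1 else 0 :=
    fun i i' => orthonormal_iff_ite.1 B.orthonormal i i'
  refine ⟨(s 0, 0), (s 1, 0), ?_, ?_, ?_, hAa _ _, hAa _ _, ?_⟩
  · rw [hs, hBB]; simp
  · rw [hs, hBB]; simp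
  · rw [hs, hs, hBB]; simp
  rintro ⟨u, t⟩ h0 h1
  rw [hs] at h0 h1
  have hKB : ∀ i, ⟪K t, (B i : F)⟫_ℝ = 0 := fun i => by
    obtain ⟨u, hu⟩ := (B i).2
    rw [← hu, real_inner_comm, hjK]
  rw [ha, inner_add_left, hKB, add_zero, real_inner_smul_left, mul_eq_zero] at h0 h1
  have hu : (⟨j u, ⟨u, rfl⟩⟩ : j.range) = 0 := by
    refine InnerProductSpace.ext_inner_right_basis B.toBasis fun i => ?_
    rw [inner_zero_left, OrthonormalBasis.coe_toBasis]
    fin_cases i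
    · exact h0.resolve_left hρ
    · exact h1.resolve_left hρ
  have hu' : u = 0 := hj ((congrArg Subtype.val hu).trans (map_zero j).symm)
  rw [hAa, hu', Prod.mk_zero_zero, smul_zero]

/-- The eigenvectors of a generated hypersurface for nonzero principal curvatures span the tangent
plane of the sphere. -/
theorem span_eigenvectors_eq {j : T →ₗ[ℝ] F} {K : W →ₗ[ℝ] F} {ρ k : ℝ} (hρ : ρ ≠ 0) (hk : k ≠ 0)
    {a b : T × W →ₗ[ℝ] F} (hinj : Function.Injective a) (ha : ∀ s t, a (s, t) = ρ • j s + K t)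
    (hb : ∀ s t, b (s, t) = k • j s)
    {A : Module.End ℝ (T × W)} (hA : A = -(a.leftInverse ∘ₗ b)) :
    (LinearMap.inl ℝ T W).range = Submodule.span ℝ {v | ∃ ν : ℝ, ν ≠ 0 ∧ A v = ν • v} := by
  have hAa : ∀ s t, A (s, t) = (-(k / ρ)) • (s, 0) := fun s t => by
    rw [hA]
    exact leftInverse_comp_apply hρ hinj ha hb s t
  apply le_antisymm
  · rintro _ ⟨s, rfl⟩
    exact Submodule.subset_span ⟨-(k / ρ), neg_ne_zero.2 (div_ne_zero hk hρ), hAa s 0⟩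
  · rw [Submodule.span_le]
    rintro ⟨s, t⟩ ⟨ν, hν, hv⟩
    rw [hAa] at hv
    have ht : t = 0 := by
      have := congrArg Prod.snd hv
      simpa [hν] using this.symm
    exact ⟨s, by rw [ht]; rfl⟩

end GeneratedAlgebra

/-! ### Generated hypersurfaces -/

section Generated

variable {n : ℕ} {V : Submodule ℝ (Ambient n)} (c : Ambient n) (r : ℝ)
  (e : OrthonormalBasis (Fin (n - 2)) ℝ Vᗮ) (i₀ : Fin (n - 2)) (α : ℝ)

theorem norm_coe_sphere (q : Metric.sphere (0 : V) 1) : ‖((q : V) : Ambient n)‖ = 1 :=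
  norm_eq_of_mem_sphere q

theorem inner_sphere_self (q : Metric.sphere (0 : V) 1) :
    ⟪((q : V) : Ambient n), ((q : V) : Ambient n)⟫_ℝ = 1 := by
  rw [real_inner_self_eq_norm_sq, norm_coe_sphere, one_pow]

theorem inner_basis_basis (i i' : Fin (n - 2)) :
    ⟪(e i : Ambient n), (e i' : Ambient n)⟫_ℝ = if i = i' then 1 else 0 :=
  orthonormal_iff_ite.1 e.orthonormal i i'

theorem inner_mem_basis {y : Ambient n} (hy : y ∈ V) (i : Fin (n - 2)) :
    ⟪y, (e i : Ambient n)⟫_ℝ = 0 :=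
  Submodule.inner_right_of_mem_orthogonal hy (e i).2

/-- The linear parametrization of the directions of the generator by its frame. -/
def generatorMap (q : Metric.sphere (0 : V) 1) :
    EuclideanSpace ℝ (Fin (n - 2)) →L[ℝ] Ambient n :=
  ∑ i, (EuclideanSpace.proj i : EuclideanSpace ℝ (Fin (n - 2)) →L[ℝ] ℝ).smulRight
    (frame e i₀ α q i)

theorem generatorMap_apply (q : Metric.sphere (0 : V) 1) (t : EuclideanSpace ℝ (Fin (n - 2))) :
    generatorMap e i₀ α q t = ∑ i, t i • frame e i₀ α q i := by
  simp [generatorMap, sum_apply]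

/-- The component of `generatorMap` in the orthogonal complement of `V`; it does not depend on the
point of the sphere. -/
def normalGeneratorMap : EuclideanSpace ℝ (Fin (n - 2)) →L[ℝ] Ambient n :=
  ∑ i, (EuclideanSpace.proj i : EuclideanSpace ℝ (Fin (n - 2)) →L[ℝ] ℝ).smulRight
    ((if i = i₀ then Real.cos α else 1) • (e i : Ambient n))

theorem normalGeneratorMap_apply (t : EuclideanSpace ℝ (Fin (n - 2))) :
    normalGeneratorMap e i₀ α t
      = ∑ i, (t i * if i = i₀ then Real.cos α else 1) • (e i : Ambient n) := by
  simp only [normalGeneratorMap, sum_apply, ContinuousLinearMap.smulRight_apply, smul_smul]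
  rfl

theorem generatorMap_eq (q : Metric.sphere (0 : V) 1) (t : EuclideanSpace ℝ (Fin (n - 2))) :
    generatorMap e i₀ α q t
      = normalGeneratorMap e i₀ α t - (t i₀ * Real.sin α) • ((q : V) : Ambient n) := by
  have h1 : ∀ i, frame e i₀ α q i = (if i = i₀ then Real.cos α else 1) • (e i : Ambient n)
      - (if i = i₀ then Real.sin α else 0) • ((q : V) : Ambient n) := fun i => by
    unfold frame
    split_ifs with hi
    · rw [hi]; module
    · module
  rw [generatorMap_apply, normalGeneratorMap_apply]
  simp only [h1, smul_sub, Finset.sum_sub_distrib, smul_smul, ← Finset.sum_smul, mul_ite, mul_zero,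
    Finset.sum_ite_eq', Finset.mem_univ, if_true]

theorem inner_generatorMap_of_mem {y : Ambient n} (hy : y ∈ V) (q : Metric.sphere (0 : V) 1)
    (t : EuclideanSpace ℝ (Fin (n - 2))) :
    ⟪y, generatorMap e i₀ α q t⟫_ℝ = -(t i₀ * Real.sin α) * ⟪y, ((q : V) : Ambient n)⟫_ℝ := by
  rw [generatorMap_eq, inner_sub_right, real_inner_smul_right, normalGeneratorMap_apply]
  simp [inner_sum, -mul_ite, real_inner_smul_right, inner_mem_basis e hy]

theorem inner_basis_generatorMap (i : Fin (n - 2)) (q : Metric.sphere (0 : V) 1)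
    (t : EuclideanSpace ℝ (Fin (n - 2))) :
    ⟪(e i : Ambient n), generatorMap e i₀ α q t⟫_ℝ = t i * if i = i₀ then Real.cos α else 1 := by
  rw [generatorMap_eq, inner_sub_right, real_inner_smul_right, real_inner_comm,
    real_inner_comm ((q : V) : Ambient n), inner_mem_basis e (q : V).2, normalGeneratorMap_apply]
  simp only [sum_inner, real_inner_smul_left, inner_basis_basis]
  simp

theorem injective_generatorMap (hα : Real.cos α ≠ 0) (q : Metric.sphere (0 : V) 1) :
    Function.Injective (generatorMap e i₀ α q) := by
  rw [injective_iff_map_eq_zero]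
  intro t ht
  ext i
  have h1 := inner_basis_generatorMap e i₀ α i q t
  rw [ht, inner_zero_right, eq_comm, mul_eq_zero] at h1
  refine h1.resolve_right ?_
  split_ifs
  · exact hα
  · exact one_ne_zero

/-- The generated hypersurface as a function on the product of the ambient space and the space of
parameters of the generators. -/
def generatedExtension (x : Ambient n × EuclideanSpace ℝ (Fin (n - 2))) : Ambient n :=
  c + (r - x.2 i₀ * Real.sin α) • x.1 + normalGeneratorMap e i₀ α x.2

theorem generated_eq (x : Metric.sphere (0 : V) 1 × EuclideanSpace ℝ (Fin (n - 2))) :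
    generated c r e i₀ α x = generatedExtension c r e i₀ α (((x.1 : V) : Ambient n), x.2) := by
  rw [generated, ← generatorMap_apply, generatorMap_eq, generatedExtension]
  module

theorem contDiff_generatedExtension : ContDiff ℝ ∞ (generatedExtension c r e i₀ α) := by
  unfold generatedExtension
  have h : ContDiff ℝ ∞ fun x : Ambient n × EuclideanSpace ℝ (Fin (n - 2)) => x.2 i₀ :=
    (EuclideanSpace.proj i₀ : EuclideanSpace ℝ (Fin (n - 2)) →L[ℝ] ℝ).contDiff.comp contDiff_snd
  exact (contDiff_const.add ((contDiff_const.sub (h.mul contDiff_const)).smul contDiff_fst)).add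
    ((normalGeneratorMap e i₀ α).contDiff.comp contDiff_snd)

theorem fderiv_generatedExtension_apply (y y' : Ambient n)
    (w w' : EuclideanSpace ℝ (Fin (n - 2))) :
    fderiv ℝ (generatedExtension c r e i₀ α) (y, w) (y', w')
      = (r - w i₀ * Real.sin α) • y' - (w' i₀ * Real.sin α) • y + normalGeneratorMap e i₀ α w' := by
  set p : Ambient n × EuclideanSpace ℝ (Fin (n - 2)) →L[ℝ] ℝ :=
    (EuclideanSpace.proj i₀ : EuclideanSpace ℝ (Fin (n - 2)) →L[ℝ] ℝ) ∘L
      ContinuousLinearMap.snd ℝ _ _ with hp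
  have h1 : HasFDerivAt (fun x : Ambient n × EuclideanSpace ℝ (Fin (n - 2)) =>
      r - x.2 i₀ * Real.sin α) (-(Real.sin α • p)) (y, w) :=
    (p.hasFDerivAt.mul_const (Real.sin α)).const_sub r
  have h2 := ((h1.smul (hasFDerivAt_fst (𝕜 := ℝ))).const_add c).add
    ((normalGeneratorMap e i₀ α).hasFDerivAt.comp (y, w) (hasFDerivAt_snd (𝕜 := ℝ)))
  have h3 : HasFDerivAt (generatedExtension c r e i₀ α) _ (y, w) := h2
  rw [h3.fderiv]
  simp [hp, sub_eq_add_neg, mul_comm]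

theorem isOpen_regularSet : IsOpen (regularSet V r i₀ α) := by
  have h : Continuous fun x : Metric.sphere (0 : V) 1 × EuclideanSpace ℝ (Fin (n - 2)) =>
      r - x.2 i₀ * Real.sin α := by fun_prop
  exact isOpen_ne_fun h continuous_const

theorem range_generated (hr : 0 < r) :
    Set.range (fun q : Metric.sphere (0 : V) 1 => generated c r e i₀ α (q, 0))
      = roundSphere V c r := by
  have hval : ∀ q : Metric.sphere (0 : V) 1,
      generated c r e i₀ α (q, 0) = c + r • ((q : V) : Ambient n) := fun q => by simp [generated]
  ext p
  simp only [hval, Set.mem_range, roundSphere, Set.mem_inter_iff, SetLike.mem_coe,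
    AffineSubspace.mem_mk', vsub_eq_sub, mem_sphere_iff_norm]
  constructor
  · rintro ⟨q, rfl⟩
    rw [add_sub_cancel_left]
    refine ⟨V.smul_mem r (q : V).2, ?_⟩
    rw [norm_smul, norm_coe_sphere, mul_one, Real.norm_eq_abs,
      abs_of_pos hr]
  · rintro ⟨hp, hpr⟩
    refine ⟨⟨r⁻¹ • ⟨p - c, hp⟩, ?_⟩, ?_⟩
    · rw [mem_sphere_zero_iff_norm, norm_smul, Submodule.coe_norm, hpr, norm_inv,
        Real.norm_eq_abs, abs_of_pos hr, inv_mul_cancel₀ hr.ne']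
    · rw [Submodule.coe_smul, smul_inv_smul₀ hr.ne']
      exact add_sub_cancel _ _

variable [Fact (Module.finrank ℝ V = 2 + 1)]

/-- The inclusion of the unit sphere of `V` in the ambient space. -/
def sphereInclusion (q : Metric.sphere (0 : V) 1) : Ambient n := (q : V)

theorem contMDiff_sphereInclusion :
    ContMDiff (𝓡 2) 𝓘(ℝ, Ambient n) ∞ (sphereInclusion (V := V)) :=
  V.subtypeL.contDiff.contMDiff.comp contMDiff_coe_sphere

/-- The differential of `sphereInclusion`, on the model space of the sphere. -/
def sphereDeriv (q : Metric.sphere (0 : V) 1) : EuclideanSpace ℝ (Fin 2) →L[ℝ] Ambient n :=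
  V.subtypeL ∘L (mvfderiv (𝓡 2) ((↑) : Metric.sphere (0 : V) 1 → V) q :)

theorem sphereDeriv_apply (q : Metric.sphere (0 : V) 1) (v : EuclideanSpace ℝ (Fin 2)) :
    sphereDeriv q v = (mvfderiv (𝓡 2) ((↑) : Metric.sphere (0 : V) 1 → V) q v : V) := rfl

theorem hasMFDerivAt_sphereInclusion (q : Metric.sphere (0 : V) 1) :
    HasMFDerivAt (𝓡 2) 𝓘(ℝ, Ambient n) (sphereInclusion (V := V)) q (sphereDeriv q) := by
  have h1 : HasMFDerivAt (𝓡 2) 𝓘(ℝ, V) ((↑) : Metric.sphere (0 : V) 1 → V) q _ :=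
    ((contMDiff_coe_sphere (n := 2) (m := 1) q).mdifferentiableAt one_ne_zero).hasMFDerivAt
  have h2 : HasFDerivAt (fun y : V => (y : Ambient n)) V.subtypeL q := V.subtypeL.hasFDerivAt
  exact h2.hasMFDerivAt.comp q h1

theorem injective_sphereDeriv (q : Metric.sphere (0 : V) 1) :
    Function.Injective (sphereDeriv q) := by
  intro v w hvw
  rw [sphereDeriv_apply, sphereDeriv_apply] at hvw
  exact injective_mvfderiv_subtypeVal_sphere q (Subtype.ext hvw)

theorem sphereDeriv_mem (q : Metric.sphere (0 : V) 1) (v : EuclideanSpace ℝ (Fin 2)) :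
    sphereDeriv q v ∈ V := by
  rw [sphereDeriv_apply]
  exact Subtype.mem _

theorem inner_sphereDeriv (q : Metric.sphere (0 : V) 1) (v : EuclideanSpace ℝ (Fin 2)) :
    ⟪sphereDeriv q v, ((q : V) : Ambient n)⟫_ℝ = 0 := by
  rw [sphereDeriv_apply, ← Submodule.coe_inner]
  have h : (mvfderiv (𝓡 2) ((↑) : Metric.sphere (0 : V) 1 → V) q v : V) ∈ (ℝ ∙ (q : V))ᗮ := by
    rw [← range_mvfderiv_subtypeVal (n := 2)]
    exact ⟨v, rfl⟩
  rw [real_inner_comm]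
  exact Submodule.mem_orthogonal_singleton_iff_inner_right.1 h

theorem hasMFDerivAt_sphereInclusion_prod
    (x : Metric.sphere (0 : V) 1 × EuclideanSpace ℝ (Fin (n - 2))) :
    HasMFDerivAt ((𝓡 2).prod (𝓡 (n - 2))) 𝓘(ℝ, Ambient n × EuclideanSpace ℝ (Fin (n - 2)))
      (fun x : Metric.sphere (0 : V) 1 × EuclideanSpace ℝ (Fin (n - 2)) =>
        (sphereInclusion x.1, x.2)) x
      ((sphereDeriv x.1).prodMap
        (ContinuousLinearMap.id ℝ (EuclideanSpace ℝ (Fin (n - 2))))) := by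
  have h1 := (hasMFDerivAt_sphereInclusion x.1).comp x
    (hasMFDerivAt_fst (I := 𝓡 2) (I' := 𝓡 (n - 2)) x)
  have h2 := hasMFDerivAt_snd (I := 𝓡 2) (I' := 𝓡 (n - 2)) x
  exact ⟨h1.1.prodMk h2.1, h1.2.prodMk h2.2⟩

theorem contMDiff_sphereInclusion_prod :
    ContMDiff ((𝓡 2).prod (𝓡 (n - 2))) 𝓘(ℝ, Ambient n × EuclideanSpace ℝ (Fin (n - 2))) ∞
      (fun x : Metric.sphere (0 : V) 1 × EuclideanSpace ℝ (Fin (n - 2)) =>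
        (sphereInclusion x.1, x.2)) :=
  (contMDiff_sphereInclusion.comp contMDiff_fst).prodMk_space contMDiff_snd

theorem contMDiff_generated : ContMDiff ((𝓡 2).prod (𝓡 (n - 2))) 𝓘(ℝ, Ambient n) ∞
    (generated c r e i₀ α) := by
  have h : generated c r e i₀ α = generatedExtension c r e i₀ α ∘
      fun x => (sphereInclusion x.1, x.2) := funext fun x => generated_eq c r e i₀ α x
  rw [h]
  exact (contDiff_generatedExtension c r e i₀ α).contMDiff.comp contMDiff_sphereInclusion_prod

theorem contMDiff_generatedNormal : ContMDiff ((𝓡 2).prod (𝓡 (n - 2))) 𝓘(ℝ, Ambient n) ∞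
    (generatedNormal e i₀ α) := by
  have h : ContDiff ℝ ∞ fun x : Ambient n × EuclideanSpace ℝ (Fin (n - 2)) =>
      Real.cos α • x.1 + Real.sin α • (e i₀ : Ambient n) :=
    (contDiff_fst.const_smul (Real.cos α)).add contDiff_const
  exact h.contMDiff.comp contMDiff_sphereInclusion_prod

theorem mvfderiv_generated_apply (x : Metric.sphere (0 : V) 1 × EuclideanSpace ℝ (Fin (n - 2)))
    (s : EuclideanSpace ℝ (Fin 2)) (t : EuclideanSpace ℝ (Fin (n - 2))) :
    mvfderiv ((𝓡 2).prod (𝓡 (n - 2))) (generated c r e i₀ α) x (s, t)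
      = (r - x.2 i₀ * Real.sin α) • sphereDeriv x.1 s
        + generatorMap e i₀ α x.1 t := by
  have h : generated c r e i₀ α = generatedExtension c r e i₀ α ∘
      fun x => (sphereInclusion x.1, x.2) := funext fun x => generated_eq c r e i₀ α x
  have h1 := ((contDiff_generatedExtension c r e i₀ α).differentiable (by simp)
    (sphereInclusion x.1, x.2)).hasFDerivAt
  have h2 := (h1.hasMFDerivAt.comp x (hasMFDerivAt_sphereInclusion_prod x)).mfderiv
  rw [← h] at h2
  refine (congrArg (fun L => L (s, t)) h2).trans ?_
  refine (fderiv_generatedExtension_apply c r e i₀ α _ _ _ _).trans ?_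
  rw [generatorMap_eq]
  change _ • sphereDeriv x.1 s - (t i₀ * _) • ((x.1 : V) : Ambient n) + _ = _
  abel_nf
  rfl

theorem mvfderiv_generatedNormal_apply
    (x : Metric.sphere (0 : V) 1 × EuclideanSpace ℝ (Fin (n - 2)))
    (s : EuclideanSpace ℝ (Fin 2)) (t : EuclideanSpace ℝ (Fin (n - 2))) :
    mvfderiv ((𝓡 2).prod (𝓡 (n - 2))) (generatedNormal e i₀ α) x (s, t)
      = Real.cos α • sphereDeriv x.1 s := by
  have h1 : HasFDerivAt (fun y : Ambient n × EuclideanSpace ℝ (Fin (n - 2)) =>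
      Real.cos α • y.1 + Real.sin α • (e i₀ : Ambient n))
      (Real.cos α • ContinuousLinearMap.fst ℝ _ _) (sphereInclusion x.1, x.2) :=
    (hasFDerivAt_fst.fun_const_smul _).add_const _
  have h2 := (h1.hasMFDerivAt.comp x (hasMFDerivAt_sphereInclusion_prod x)).mfderiv
  exact congrArg (fun L => L (s, t)) h2

theorem inner_sphereDeriv_generatorMap (q : Metric.sphere (0 : V) 1)
    (s : EuclideanSpace ℝ (Fin 2)) (t : EuclideanSpace ℝ (Fin (n - 2))) :
    ⟪sphereDeriv q s, generatorMap e i₀ α q t⟫_ℝ = 0 := by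
  rw [inner_generatorMap_of_mem e i₀ α (sphereDeriv_mem q s),
    inner_sphereDeriv, mul_zero]

theorem injective_mvfderiv_generated (hα : Real.cos α ≠ 0)
    {x : Metric.sphere (0 : V) 1 × EuclideanSpace ℝ (Fin (n - 2))} (hx : x ∈ regularSet V r i₀ α) :
    Function.Injective (mvfderiv ((𝓡 2).prod (𝓡 (n - 2))) (generated c r e i₀ α) x) :=
  injective_of_orthogonal_sum (T := EuclideanSpace ℝ (Fin 2))
    (W := EuclideanSpace ℝ (Fin (n - 2)))
    (j := (sphereDeriv x.1).toLinearMap)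
    (K := (generatorMap e i₀ α x.1).toLinearMap)
    (a := (mvfderiv ((𝓡 2).prod (𝓡 (n - 2))) (generated c r e i₀ α) x).toLinearMap)
    (injective_sphereDeriv x.1) (injective_generatorMap e i₀ α hα x.1)
    (inner_sphereDeriv_generatorMap e i₀ α x.1) hx (mvfderiv_generated_apply c r e i₀ α x)

theorem inner_generatedNormal_mvfderiv
    (x : Metric.sphere (0 : V) 1 × EuclideanSpace ℝ (Fin (n - 2)))
    (s : EuclideanSpace ℝ (Fin 2)) (t : EuclideanSpace ℝ (Fin (n - 2))) :
    ⟪generatedNormal e i₀ α x,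
      mvfderiv ((𝓡 2).prod (𝓡 (n - 2))) (generated c r e i₀ α) x (s, t)⟫_ℝ = 0 := by
  rw [mvfderiv_generated_apply, generatedNormal]
  simp only [inner_add_left, inner_add_right, real_inner_smul_left, real_inner_smul_right,
    inner_basis_generatorMap, inner_generatorMap_of_mem e i₀ α (x.1 : V).2, inner_sphere_self,
    if_true]
  rw [real_inner_comm, inner_sphereDeriv, real_inner_comm,
    inner_mem_basis e (sphereDeriv_mem x.1 s)]
  ring

theorem isBiUmbilical_generated (hn : 3 ≤ n) (hα : Real.cos α ≠ 0) :
    IsBiUmbilical ((𝓡 2).prod (𝓡 (n - 2))) (regularSet V r i₀ α)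
      (generated c r e i₀ α) (generatedNormal e i₀ α) where
  isOpen := isOpen_regularSet r i₀ α
  finrank_eq := by
    rw [Module.finrank_prod, finrank_euclideanSpace_fin, finrank_euclideanSpace_fin]
    omega
  contMDiffOn := (contMDiff_generated c r e i₀ α).contMDiffOn
  injective_deriv x hx := injective_mvfderiv_generated c r e i₀ α hα hx
  normal_contMDiffOn := (contMDiff_generatedNormal e i₀ α).contMDiffOn
  normal_norm x _ := by
    rw [← sq_eq_sq₀ (norm_nonneg _) zero_le_one, ← real_inner_self_eq_norm_sq, generatedNormal]
    simp only [inner_add_left, inner_add_right, real_inner_smul_left, real_inner_smul_right,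
      inner_sphere_self, inner_basis_basis, inner_mem_basis e (x.1 : V).2,
      real_inner_comm ((x.1 : V) : Ambient n) (e i₀ : Ambient n), if_true]
    linear_combination Real.cos_sq_add_sin_sq α
  normal_orthogonal x _ v := inner_generatedNormal_mvfderiv c r e i₀ α x v.1 v.2
  biumbilical x hx := by
    have hν : -(Real.cos α / (r - x.2 i₀ * Real.sin α)) ≠ 0 := neg_ne_zero.2 (div_ne_zero hα hx)
    refine ⟨_, hν, hν, ?_⟩
    exact exists_principal_vectors (T := EuclideanSpace ℝ (Fin 2))
      (W := EuclideanSpace ℝ (Fin (n - 2)))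
      (j := (sphereDeriv x.1).toLinearMap)
      (K := (generatorMap e i₀ α x.1).toLinearMap)
      (a := (mvfderiv ((𝓡 2).prod (𝓡 (n - 2))) (generated c r e i₀ α) x).toLinearMap)
      (b := (mvfderiv ((𝓡 2).prod (𝓡 (n - 2))) (generatedNormal e i₀ α) x).toLinearMap)
      (by simp) (injective_sphereDeriv x.1)
      (inner_sphereDeriv_generatorMap e i₀ α x.1) hx (injective_mvfderiv_generated c r e i₀ α hα hx)
      (mvfderiv_generated_apply c r e i₀ α x) (mvfderiv_generatedNormal_apply e i₀ α x) rfl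

theorem isIntegralSurface_generated (hr : 0 < r) (hα : Real.cos α ≠ 0) :
    IsIntegralSurface ((𝓡 2).prod (𝓡 (n - 2))) (regularSet V r i₀ α)
      (generated c r e i₀ α) (generatedNormal e i₀ α)
      (fun q : Metric.sphere (0 : V) 1 => (q, 0)) := by
  have hmem : ∀ q : Metric.sphere (0 : V) 1, (q, 0) ∈ regularSet V r i₀ α := fun q => by
    simp [regularSet, hr.ne']
  refine ⟨hmem, contMDiff_id.prodMk contMDiff_const, fun q => ?_, fun q => ?_⟩
  · rw [mfderiv_prod_left]
    exact LinearMap.inl_injective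
  · rw [mfderiv_prod_left]
    exact span_eigenvectors_eq (T := EuclideanSpace ℝ (Fin 2))
      (W := EuclideanSpace ℝ (Fin (n - 2)))
      (j := (sphereDeriv q).toLinearMap)
      (K := (generatorMap e i₀ α q).toLinearMap)
      (a := (mvfderiv ((𝓡 2).prod (𝓡 (n - 2))) (generated c r e i₀ α) (q, 0)).toLinearMap)
      (b := (mvfderiv ((𝓡 2).prod (𝓡 (n - 2))) (generatedNormal e i₀ α) (q, 0)).toLinearMap)
      (hmem q) hα (injective_mvfderiv_generated c r e i₀ α hα (hmem q))
      (mvfderiv_generated_apply c r e i₀ α (q, 0))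
      (mvfderiv_generatedNormal_apply e i₀ α (q, 0)) rfl

end Generated

end BiUmbilical

end

theorem theorem3p1 (n : ℕ) (hn : 3 ≤ n) :
    -- integral surfaces of `Δ` lie on round 2-spheres
    (∀ {E₀ : Type*} [NormedAddCommGroup E₀] [NormedSpace ℝ E₀]
        {H : Type*} [TopologicalSpace H] (I : ModelWithCorners ℝ E₀ H) [I.Boundaryless]
        {M : Type*} [TopologicalSpace M] [ChartedSpace H M] [IsManifold I ∞ M]
        (U : Set M) (f N : M → BiUmbilical.Ambient n),
        BiUmbilical.IsBiUmbilical I U f N →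
        ∀ {S : Type*} [TopologicalSpace S] [ChartedSpace (EuclideanSpace ℝ (Fin 2)) S]
          [IsManifold (𝓡 2) ∞ S] [ConnectedSpace S] (φ : S → M),
          BiUmbilical.IsIntegralSurface I U f N φ →
          ∃ (V : Submodule ℝ (BiUmbilical.Ambient n)) (c : BiUmbilical.Ambient n) (r : ℝ),
            Module.finrank ℝ V = 3 ∧ 0 < r ∧
              ∀ s, f (φ s) ∈ BiUmbilical.roundSphere V c r) ∧
    -- every 2-sphere generates a family of bi-umbilical hypersurfaces of type number two
    (∀ (V : Submodule ℝ (BiUmbilical.Ambient n)) [Fact (Module.finrank ℝ V = 2 + 1)]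
        (c : BiUmbilical.Ambient n) (r : ℝ), 0 < r →
        ∀ (e : OrthonormalBasis (Fin (n - 2)) ℝ Vᗮ) (i₀ : Fin (n - 2)) (α : ℝ), Real.cos α ≠ 0 →
          BiUmbilical.IsBiUmbilical ((𝓡 2).prod (𝓡 (n - 2))) (BiUmbilical.regularSet V r i₀ α)
              (BiUmbilical.generated c r e i₀ α) (BiUmbilical.generatedNormal e i₀ α) ∧
            Set.range (fun q : Metric.sphere (0 : V) 1 => BiUmbilical.generated c r e i₀ α (q, 0)) =
              BiUmbilical.roundSphere V c r ∧
            BiUmbilical.IsIntegralSurface ((𝓡 2).prod (𝓡 (n - 2)))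
              (BiUmbilical.regularSet V r i₀ α)
              (BiUmbilical.generated c r e i₀ α) (BiUmbilical.generatedNormal e i₀ α)
              (fun q : Metric.sphere (0 : V) 1 => (q, 0))) := by
  refine ⟨?_, ?_⟩
  · intro _ _ _ _ _ _ _ _ _ _ _ _ _ _ h _ _ _ _ _ _ hφ
    exact hφ.exists_roundSphere h
  · intro V _ c r hr e i₀ α hα
    exact ⟨BiUmbilical.isBiUmbilical_generated c r e i₀ α hn hα,
      BiUmbilical.range_generated c r e i₀ α hr,
      BiUmbilical.isIntegralSurface_generated c r e i₀ α hr hα⟩
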